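/- Let $n\ge 0$ and $m\ge 1$ be integers. An $m$-colored matching on $[2n]=\{1,\ldots,2n\}$ is a set of $n$ arcs $(i,j)$ with $1\le i<j\le 2n$, such that every element of $[2n]$ is an endpoint of exactly one arc, together with an assignment of one of $m$ fixed colors to each arc. A $k$-crossing (respectively, a $k$-nesting) of such a matching $M$ is a set of $k$ arcs $(i_1,j_1),\ldots,(i_k,j_k)$ of $M$, all of the same color, with $i_1<i_2<\cdots<i_k<j_1<j_2<\cdots<j_k$ (respectively, $i_1<i_2<\cdots<i_k<j_k<\cdots<j_2<j_1$). The crossing number $\mathrm{cr}(M)$ (respectively, the nesting number $\mathrm{ne}(M)$) is the largest $k$ such that $M$ has a $k$-crossing (respectively, a $k$-nesting); the empty set counts as a $0$-crossing and a $0$-nesting. Then $\mathrm{cr}$ and $\mathrm{ne}$ have a symmetric joint distribution over all $m$-colored matchings on $[2n]$: for all integers $i,j\ge 0$, the number of $m$-colored matchings $M$ on $[2n]$ with $\mathrm{cr}(M)=i$ and $\mathrm{ne}(M)=j$ equals the number of those with $\mathrm{cr}(M)=j$ and $\mathrm{ne}(M)=i$. -/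

import Mathlib

/-- An arc with a color in `Fin m` (one of `m` colors), drawn over the vertices `Fin (2 * n)`, that
is, over `2n` points on a line. The vertex set `{1, …, 2n}` is indexed from `0`, and the arc is the
pair `(left, right)` with `left < right`. -/
@[ext]
structure ColoredArc (n m : ℕ) where
  left : Fin (2 * n)
  right : Fin (2 * n)
  left_lt_right : left < right
  color : Fin m

/-- An `m`-colored matching on `2n` points: a set of colored arcs such that every vertex is an
endpoint of exactly one of them. (In particular no two arcs of the set join the same two vertices,
so the underlying set of pairs is a perfect matching and each arc has exactly one color.) -/
@[ext]
structure ColoredMatching (n m : ℕ) where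
  arcs : Set (ColoredArc n m)
  existsUnique_arc : ∀ v : Fin (2 * n), ∃! a, a ∈ arcs ∧ (a.left = v ∨ a.right = v)

instance (n m : ℕ) : Finite (ColoredArc n m) :=
  Finite.of_injective (fun a => (a.left, a.right, a.color)) fun a b h => by
    simp only [Prod.mk.injEq] at h
    exact ColoredArc.ext h.1 h.2.1 h.2.2

instance (n m : ℕ) : Finite (ColoredMatching n m) :=
  Finite.of_injective ColoredMatching.arcs fun _ _ h => ColoredMatching.ext h

namespace ColoredMatching

variable {n m : ℕ}

/-- `M` has a `k`-crossing: `k` arcs `(i₁, j₁), …, (i_k, j_k)` of `M`, all of the same color, with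
`i₁ < ⋯ < i_k < j₁ < ⋯ < j_k`. -/
def HasCrossing (M : ColoredMatching n m) (k : ℕ) : Prop :=
  ∃ a : Fin k → ColoredArc n m,
    (∀ s, a s ∈ M.arcs) ∧ (∀ s t, (a s).color = (a t).color) ∧
    StrictMono (fun s => (a s).left) ∧ (∀ s t, (a s).left < (a t).right) ∧
    StrictMono (fun s => (a s).right)

/-- `M` has a `k`-nesting: `k` arcs `(i₁, j₁), …, (i_k, j_k)` of `M`, all of the same color, with
`i₁ < ⋯ < i_k < j_k < ⋯ < j₁`. -/
def HasNesting (M : ColoredMatching n m) (k : ℕ) : Prop :=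
  ∃ a : Fin k → ColoredArc n m,
    (∀ s, a s ∈ M.arcs) ∧ (∀ s t, (a s).color = (a t).color) ∧
    StrictMono (fun s => (a s).left) ∧ (∀ s t, (a s).left < (a t).right) ∧
    StrictAnti (fun s => (a s).right)

/-- The crossing number: the largest `k` such that `M` has a `k`-crossing. -/
noncomputable def crossingNumber (M : ColoredMatching n m) : ℕ :=
  sSup {k | M.HasCrossing k}

/-- The nesting number: the largest `k` such that `M` has a `k`-nesting. -/
noncomputable def nestingNumber (M : ColoredMatching n m) : ℕ :=
  sSup {k | M.HasNesting k}

/-- The supremum defining the crossing number is an attained maximum. -/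
theorem isGreatest_crossingNumber (M : ColoredMatching n m) :
    IsGreatest {k | M.HasCrossing k} M.crossingNumber := by
  have hb : BddAbove {k | M.HasCrossing k} := by
    refine ⟨2 * n, ?_⟩
    rintro k ⟨a, -, -, hl, -, -⟩
    simpa using Fintype.card_le_of_injective _ hl.injective
  have h0 : M.HasCrossing 0 :=
    ⟨Fin.elim0, fun s => s.elim0, fun s => s.elim0, fun s => s.elim0, fun s => s.elim0,
      fun s => s.elim0⟩
  exact ⟨Nat.sSup_mem ⟨0, h0⟩ hb, fun k hk => le_csSup hb hk⟩

/-- The supremum defining the nesting number is an attained maximum. -/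
theorem isGreatest_nestingNumber (M : ColoredMatching n m) :
    IsGreatest {k | M.HasNesting k} M.nestingNumber := by
  have hb : BddAbove {k | M.HasNesting k} := by
    refine ⟨2 * n, ?_⟩
    rintro k ⟨a, -, -, hl, -, -⟩
    simpa using Fintype.card_le_of_injective _ hl.injective
  have h0 : M.HasNesting 0 :=
    ⟨Fin.elim0, fun s => s.elim0, fun s => s.elim0, fun s => s.elim0, fun s => s.elim0,
      fun s => s.elim0⟩
  exact ⟨Nat.sSup_mem ⟨0, h0⟩ hb, fun k hk => le_csSup hb hk⟩

end ColoredMatching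

/-! At each cut between consecutive vertices, and for each color, list the left endpoints of the
arcs crossing the cut by decreasing right endpoint. Any `k`-crossing or `k`-nesting lies over a
single cut; there a nesting is an increasing sublist of the word of its color and a crossing is a
decreasing one. Row insertion turns the word into a tableau, and by Schensted's theorem its longest
increasing and decreasing sublists are measured by the first row and the first column. So the
nesting number is the maximal row length and the crossing number the maximal column length over all
cuts and colors.

Moving the cut leftwards over a vertex changes one tableau by one box. A right endpoint appends the
left endpoint of its arc to the word, which is a row insertion; a left endpoint is the largest entry
and gets deleted. Given the shapes, both moves can be undone from left to right, so one may
transpose all shapes and rebuild a matching. This exchanges the two statistics. Transposition is a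
symmetric, single-valued relation, so it injects each of the two sets to be counted into the other.

A state at a cut holds the completed arcs on the left and the tableaux, hence it determines
everything to its left. Transposed histories exist by `Open.exists_conj` and `Close.exists_conj`,
which rest on reverse insertion (`Insert.exists_rev`), and are unique by `Conjugate.unique`. The
link to words is `Insert.wordEquiv` with `Represents.hasChain_lt` and `Represents.hasChain_gt`. Full
Knuth equivalence is not needed: it is enough that monotone sublists can be exchanged for others of
equal length with no worse bounds. -/

/-! ### Exchanging monotone sublists of words. -/

/-- Every `r`-chain among the sublists of `W` can be replaced by one of `W'` of the same length,
compatibly with everything that precedes or follows it. -/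
def ChainLE (r : ℕ → ℕ → Prop) (W W' : List ℕ) : Prop :=
  ∀ l : List ℕ, l.Sublist W → l.Pairwise r → ∃ l' : List ℕ, l'.Sublist W' ∧ l'.Pairwise r ∧ l'.length = l.length ∧
    (∀ u, (∀ v ∈ l, r u v) → ∀ v ∈ l', r u v) ∧ (∀ u, (∀ v ∈ l, r v u) → ∀ v ∈ l', r v u)

/-- `W` has a sublist of length `k` which is an `r`-chain. -/
def HasChain (r : ℕ → ℕ → Prop) (W : List ℕ) (k : ℕ) : Prop :=
  ∃ l : List ℕ, l.Sublist W ∧ l.Pairwise r ∧ l.length = k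

namespace ChainLE

variable {r : ℕ → ℕ → Prop} {W W' W'' V V' : List ℕ}

theorem refl (W : List ℕ) : ChainLE r W W := fun l h1 h2 =>
  ⟨l, h1, h2, rfl, fun _ h => h, fun _ h => h⟩

theorem trans (h : ChainLE r W W') (h' : ChainLE r W' W'') : ChainLE r W W'' := by
  intro l h1 h2
  obtain ⟨l', a1, a2, a3, a4, a5⟩ := h l h1 h2
  obtain ⟨l'', b1, b2, b3, b4, b5⟩ := h' l' a1 a2
  exact ⟨l'', b1, b2, b3.trans a3, fun u hu => b4 u (a4 u hu), fun u hu => b5 u (a5 u hu)⟩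

/-- The bound clauses of `ChainLE` exist for this: they let the two replaced pieces still fit
together. -/
theorem append (h : ChainLE r W W') (h' : ChainLE r V V') : ChainLE r (W ++ V) (W' ++ V') := by
  intro l h1 h2
  obtain ⟨l1, l2, rfl, s1, s2⟩ := List.sublist_append_iff.1 h1
  rw [List.pairwise_append] at h2
  obtain ⟨p1, p2, p3⟩ := h2
  obtain ⟨l1', a1, a2, a3, a4, a5⟩ := h l1 s1 p1
  obtain ⟨l2', b1, b2, b3, b4, b5⟩ := h' l2 s2 p2
  refine ⟨l1' ++ l2', a1.append b1, ?_, by simp [a3, b3], ?_, ?_⟩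
  · rw [List.pairwise_append]
    refine ⟨a2, b2, fun a ha b hb => ?_⟩
    exact b4 a (fun v hv => a5 v (fun w hw => p3 w hw v hv) a ha) b hb
  · intro u hu v hv
    rcases List.mem_append.1 hv with hv | hv
    · exact a4 u (fun w hw => hu w (List.mem_append_left _ hw)) v hv
    · exact b4 u (fun w hw => hu w (List.mem_append_right _ hw)) v hv
  · intro u hu v hv
    rcases List.mem_append.1 hv with hv | hv
    · exact a5 u (fun w hw => hu w (List.mem_append_left _ hw)) v hv
    · exact b5 u (fun w hw => hu w (List.mem_append_right _ hw)) v hv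

theorem hasChain (h : ChainLE r W W') {k : ℕ} (hk : HasChain r W k) : HasChain r W' k := by
  obtain ⟨l, h1, h2, h3⟩ := hk
  obtain ⟨l', a1, a2, a3, -, -⟩ := h l h1 h2
  exact ⟨l', a1, a2, a3.trans h3⟩

/-- A chain below `t` is replaced by one below `t`: this is one of the bound clauses with `u = t`.
-/
theorem filter_left (t : ℕ) (h : ChainLE r W W')
    (hr : (∀ u v, r u v ↔ u < v) ∨ (∀ u v, r u v ↔ v < u)) :
    ChainLE r (W.filter (· < t)) (W'.filter (· < t)) := by
  intro l h1 h2
  obtain ⟨l', a1, a2, a3, a4, a5⟩ := h l (h1.trans List.filter_sublist) h2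
  have hl : ∀ v ∈ l, v < t := fun v hv => by simpa using (List.mem_filter.1 (h1.subset hv)).2
  have hl' : ∀ v ∈ l', v < t := by
    rcases hr with hr | hr
    · simpa only [hr] using a5 t (by simpa only [hr] using hl)
    · simpa only [hr] using a4 t (by simpa only [hr] using hl)
  refine ⟨l', ?_, a2, a3, a4, a5⟩
  have := a1.filter (fun v => decide (v < t))
  rwa [List.filter_eq_self.2 (by simpa using hl')] at this

end ChainLE

/-! ### Bumping one entry out of a row. -/

section Bump

variable {A B : List ℕ} {x y : ℕ}

theorem length_le_one_of_pairwise {l : List ℕ} (h : l.Pairwise (· < ·)) (h' : l.Pairwise (· > ·)) :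
    l = [] ∨ ∃ v, l = [v] := by
  rcases l with _ | ⟨a, _ | ⟨b, l⟩⟩
  · exact Or.inl rfl
  · exact Or.inr ⟨a, rfl⟩
  · have h1 := List.rel_of_pairwise_cons h (List.mem_cons_self (a := b) (l := l))
    have h2 := List.rel_of_pairwise_cons h' (List.mem_cons_self (a := b) (l := l))
    omega

theorem pairwise_row (hA : A.Pairwise (· < ·)) (hB : B.Pairwise (· < ·)) (z : ℕ)
    (hAz : ∀ a ∈ A, a < z) (hBz : ∀ b ∈ B, z < b) : (A ++ z :: B).Pairwise (· < ·) := by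
  rw [List.pairwise_append, List.pairwise_cons]
  refine ⟨hA, ⟨hBz, hB⟩, fun a ha b hb => ?_⟩
  rcases List.mem_cons.1 hb with rfl | hb
  · exact hAz a ha
  · exact (hAz a ha).trans (hBz b hb)

/-- An increasing row gives at most one entry `v` to a decreasing sublist. If `x` follows it, then
`v ≥ y`, so `[y, x]` can stand in for `[v, x]`. -/
theorem chainLE_gt_bump (hA : A.Pairwise (· < ·)) (hB : B.Pairwise (· < ·))
    (hAx : ∀ a ∈ A, a < x) (hxy : x < y) (hyB : ∀ b ∈ B, y < b) :
    ChainLE (· > ·) (A ++ y :: B ++ [x]) (y :: (A ++ x :: B)) := by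
  have hR := pairwise_row hA hB y (fun a ha => (hAx a ha).trans hxy) hyB
  intro l h1 h2
  obtain ⟨l1, l2, rfl, s1, s2⟩ := List.sublist_append_iff.1 h1
  rw [List.pairwise_append] at h2
  have hl2 : l2 = [] ∨ l2 = [x] := by simpa using s2
  rcases length_le_one_of_pairwise (hR.sublist s1) h2.1 with rfl | ⟨v, rfl⟩
  · rcases hl2 with rfl | rfl
    · exact ⟨[], by simp, by simp, rfl, by simp, by simp⟩
    · exact ⟨[x], by simp, by simp, rfl, by simp, by simp⟩
  · have hv : v ∈ A ++ y :: B := by simpa using s1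
    rcases hl2 with rfl | rfl
    · refine ⟨[v], ?_, by simp, rfl, by simp, by simp⟩
      simp at hv ⊢; tauto
    · have hvx : x < v := by simpa using h2.2.2
      have hyv : y ≤ v := by
        rcases List.mem_append.1 hv with h | h
        · have := hAx v h; omega
        · rcases List.mem_cons.1 h with rfl | h
          · exact le_rfl
          · exact (hyB v h).le
      refine ⟨[y, x], by simp, by simpa using hxy, rfl, ?_, ?_⟩
      · simp; intros; omega
      · simp; intros; omega

/-- If `y` is followed by a row entry `v`, then `v < y` forces `v ≤ x`, so `[y, x]` can stand in for
`[y, v]`. -/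
theorem chainLE_gt_unbump (hA : A.Pairwise (· < ·)) (hB : B.Pairwise (· < ·))
    (hAx : ∀ a ∈ A, a < x) (hxy : x < y) (hyB : ∀ b ∈ B, y < b) :
    ChainLE (· > ·) (y :: (A ++ x :: B)) (A ++ y :: B ++ [x]) := by
  have hR := pairwise_row hA hB x hAx (fun b hb => hxy.trans (hyB b hb))
  intro l h1 h2
  rw [← List.singleton_append] at h1
  obtain ⟨l1, l2, rfl, s1, s2⟩ := List.sublist_append_iff.1 h1
  rw [List.pairwise_append] at h2
  have hl1 : l1 = [] ∨ l1 = [y] := by simpa using s1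
  rcases length_le_one_of_pairwise (hR.sublist s2) h2.2.1 with rfl | ⟨v, rfl⟩
  · rcases hl1 with rfl | rfl
    · exact ⟨[], by simp, by simp, rfl, by simp, by simp⟩
    · exact ⟨[y], by simp, by simp, rfl, by simp, by simp⟩
  · have hv : v ∈ A ++ x :: B := by simpa using s2
    rcases hl1 with rfl | rfl
    · refine ⟨[v], ?_, by simp, rfl, by simp, by simp⟩
      simp at hv ⊢; tauto
    · have hvx : v < y := by simpa using h2.2.2
      have hyv : v ≤ x := by
        rcases List.mem_append.1 hv with h | h
        · exact (hAx v h).le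
        · rcases List.mem_cons.1 h with rfl | h
          · exact le_rfl
          · have := hyB v h; omega
      refine ⟨[y] ++ [x], List.Sublist.append (by simp) (by simp), by simpa using hxy, rfl, ?_, ?_⟩
      · simp; intros; omega
      · simp; intros; omega

theorem sublist_left_of_forall {l C D : List ℕ} (h : l.Sublist (C ++ D)) (hD : ∀ v ∈ l, v ∉ D) :
    l.Sublist C := by
  obtain ⟨l1, l2, rfl, s1, s2⟩ := List.sublist_append_iff.1 h
  have : l2 = [] := List.eq_nil_iff_forall_not_mem.2 fun v hv =>
    hD v (List.mem_append_right _ hv) (s2.subset hv)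
  simpa [this] using s1

theorem sublist_right_of_forall {l C D : List ℕ} (h : l.Sublist (C ++ D)) (hD : ∀ v ∈ l, v ∉ C) :
    l.Sublist D := by
  obtain ⟨l1, l2, rfl, s1, s2⟩ := List.sublist_append_iff.1 h
  have : l1 = [] := List.eq_nil_iff_forall_not_mem.2 fun v hv =>
    hD v (List.mem_append_left _ hv) (s1.subset hv)
  simpa [this] using s2

/-- Only a sublist running from `A` through `y` needs a change: `y` becomes `x`, whose lower bounds
come from the first entry taken from `A`. A sublist ending in the last `x` takes all else from `A`.
-/
theorem chainLE_lt_bump (hAx : ∀ a ∈ A, a < x) (hxy : x < y) (hyB : ∀ b ∈ B, y < b) :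
    ChainLE (· < ·) (A ++ y :: B ++ [x]) (y :: (A ++ x :: B)) := by
  intro l h1 h2
  obtain ⟨l1, l2, rfl, s1, s2⟩ := List.sublist_append_iff.1 h1
  have hl2 : l2 = [] ∨ l2 = [x] := by simpa using s2
  rcases hl2 with rfl | rfl
  · rw [List.append_nil] at h2 ⊢
    obtain ⟨a, b, rfl, sa, sx⟩ := List.sublist_append_iff.1 s1
    rcases List.sublist_cons_iff.1 sx with sb | ⟨b', rfl, sb⟩
    · exact ⟨a ++ b, (sa.append (sb.cons _)).cons _, h2, rfl, fun _ h => h, fun _ h => h⟩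
    · rcases a with _ | ⟨a0, a⟩
      · refine ⟨y :: b', ?_, h2, rfl, fun _ h => h, fun _ h => h⟩
        exact ((List.nil_sublist A).append (sb.cons x)).cons_cons y
      · have ha0 := hAx a0 (sa.subset (by simp))
        refine ⟨a0 :: a ++ x :: b', (sa.append (sb.cons_cons _)).cons _, ?_, by simp, ?_, ?_⟩
        · obtain ⟨p1, p2, p3⟩ := List.pairwise_append.1 h2
          obtain ⟨p4, p5⟩ := List.pairwise_cons.1 p2
          refine List.pairwise_append.2 ⟨p1, List.pairwise_cons.2
            ⟨fun v hv => hxy.trans (p4 v hv), p5⟩, fun v hv w hw => ?_⟩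
          rcases List.mem_cons.1 hw with rfl | hw
          · exact hAx v (sa.subset hv)
          · exact p3 v hv w (by simp [hw])
        · intro u hu v hv
          have := hu a0 (by simp)
          simp at hv hu
          rcases hv with rfl | hv | rfl | hv
          · exact this
          · exact hu.2 v (Or.inl hv)
          · omega
          · exact hu.2 v (Or.inr (Or.inr hv))
        · intro u hu v hv
          have := hu y (by simp)
          simp at hv hu
          rcases hv with rfl | hv | rfl | hv
          · exact hu.1
          · exact hu.2 v (Or.inl hv)
          · omega
          · exact hu.2 v (Or.inr (Or.inr hv))
  · refine ⟨l1 ++ [x], List.Sublist.cons _ ?_, h2, rfl, fun _ h => h, fun _ h => h⟩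
    refine List.Sublist.append (sublist_left_of_forall s1 fun v hv hv' => ?_) (by simp)
    have : v < x := (List.pairwise_append.1 h2).2.2 v hv x (by simp)
    rcases List.mem_cons.1 hv' with rfl | hv'
    · omega
    · have := hyB v hv'; omega

/-- If a sublist goes on from `x` into `B`, then `x` becomes `y`, whose upper bounds come from the
next entry. If it stops at `x`, the final `x` is used. A sublist starting with the front `y`
continues only in `B`. -/
theorem chainLE_lt_unbump (hAx : ∀ a ∈ A, a < x) (hxy : x < y) (hyB : ∀ b ∈ B, y < b) :
    ChainLE (· < ·) (y :: (A ++ x :: B)) (A ++ y :: B ++ [x]) := by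
  intro l h0 h2
  rcases List.sublist_cons_iff.1 h0 with h1 | ⟨l, rfl, h1⟩
  · obtain ⟨a, b, rfl, sa, sx⟩ := List.sublist_append_iff.1 h1
    rcases List.sublist_cons_iff.1 sx with sb | ⟨b', rfl, sb⟩
    · refine ⟨a ++ b, ?_, h2, rfl, fun _ h => h, fun _ h => h⟩
      exact (sa.append (sb.cons _)).trans (List.sublist_append_left _ _)
    · rcases b' with _ | ⟨b0, b⟩
      · refine ⟨a ++ [x], ?_, h2, rfl, fun _ h => h, fun _ h => h⟩
        exact (sa.trans (List.sublist_append_left _ _)).append (List.Sublist.refl _)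
      · have hb0 := hyB b0 (sb.subset (by simp))
        refine ⟨a ++ y :: b0 :: b, ?_, ?_, by simp, ?_, ?_⟩
        · exact (sa.append (sb.cons_cons _)).trans (List.sublist_append_left _ _)
        · rw [List.pairwise_append, List.pairwise_cons] at h2 ⊢
          refine ⟨h2.1, ⟨fun v hv => hyB v (sb.subset hv), h2.2.1.2⟩, fun v hv w hw => ?_⟩
          rcases List.mem_cons.1 hw with rfl | hw
          · exact (hAx v (sa.subset hv)).trans hxy
          · exact h2.2.2 v hv w (by simp only [List.mem_cons] at hw ⊢; tauto)
        · intro u hu v hv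
          have := hu x (by simp)
          by_cases hvy : v = y
          · omega
          · refine hu v ?_
            simp only [List.mem_append, List.mem_cons] at hv ⊢; tauto
        · intro u hu v hv
          have := hu b0 (by simp)
          by_cases hvy : v = y
          · omega
          · refine hu v ?_
            simp only [List.mem_append, List.mem_cons] at hv ⊢; tauto
  · refine ⟨y :: l, ?_, h2, rfl, fun _ h => h, fun _ h => h⟩
    have hl : l.Sublist B := by
      rw [List.append_cons] at h1
      refine sublist_right_of_forall h1 fun v hv hv' => ?_
      have h3 := List.rel_of_pairwise_cons h2 hv
      rcases List.mem_append.1 hv' with hv' | hv'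
      · have := hAx v hv'; omega
      · simp at hv'; omega
    exact ((hl.cons_cons y).trans (List.sublist_append_right _ _)).trans
      (List.sublist_append_left _ _)

end Bump

/-- Two words have interchangeable increasing and decreasing sublists. -/
structure WordEquiv (W W' : List ℕ) : Prop where
  lt_le : ChainLE (· < ·) W W'
  lt_ge : ChainLE (· < ·) W' W
  gt_le : ChainLE (· > ·) W W'
  gt_ge : ChainLE (· > ·) W' W

namespace WordEquiv

variable {W W' W'' V V' : List ℕ}

theorem refl (W : List ℕ) : WordEquiv W W :=
  ⟨ChainLE.refl W, ChainLE.refl W, ChainLE.refl W, ChainLE.refl W⟩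

theorem trans (h : WordEquiv W W') (h' : WordEquiv W' W'') : WordEquiv W W'' :=
  ⟨h.lt_le.trans h'.lt_le, h'.lt_ge.trans h.lt_ge, h.gt_le.trans h'.gt_le, h'.gt_ge.trans h.gt_ge⟩

theorem append (h : WordEquiv W W') (h' : WordEquiv V V') : WordEquiv (W ++ V) (W' ++ V') :=
  ⟨h.lt_le.append h'.lt_le, h.lt_ge.append h'.lt_ge, h.gt_le.append h'.gt_le,
    h.gt_ge.append h'.gt_ge⟩

theorem filter_lt (h : WordEquiv W W') (t : ℕ) :
    WordEquiv (W.filter (· < t)) (W'.filter (· < t)) :=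
  ⟨h.lt_le.filter_left t (Or.inl fun _ _ => Iff.rfl), h.lt_ge.filter_left t (Or.inl fun _ _ => Iff.rfl),
    h.gt_le.filter_left t (Or.inr fun _ _ => Iff.rfl), h.gt_ge.filter_left t (Or.inr fun _ _ => Iff.rfl)⟩

theorem hasChain_lt (h : WordEquiv W W') (k : ℕ) :
    HasChain (· < ·) W k ↔ HasChain (· < ·) W' k := ⟨h.lt_le.hasChain, h.lt_ge.hasChain⟩

theorem hasChain_gt (h : WordEquiv W W') (k : ℕ) :
    HasChain (· > ·) W k ↔ HasChain (· > ·) W' k := ⟨h.gt_le.hasChain, h.gt_ge.hasChain⟩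

theorem bump {A B : List ℕ} {x y : ℕ} (hA : A.Pairwise (· < ·)) (hB : B.Pairwise (· < ·))
    (hAx : ∀ a ∈ A, a < x) (hxy : x < y) (hyB : ∀ b ∈ B, y < b) :
    WordEquiv (A ++ y :: B ++ [x]) (y :: (A ++ x :: B)) :=
  ⟨chainLE_lt_bump hAx hxy hyB, chainLE_lt_unbump hAx hxy hyB,
    chainLE_gt_bump hA hB hAx hxy hyB, chainLE_gt_unbump hA hB hAx hxy hyB⟩

end WordEquiv

/-! ### Counting small entries of a row. -/

/-- The number of elements of `R` below `z`. -/
def cnt (z : ℕ) (R : Finset ℕ) : ℕ := (R.filter (· < z)).card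

theorem cnt_insert {a : ℕ} {E : Finset ℕ} (h : a ∉ E) (z : ℕ) :
    cnt z (insert a E) = cnt z E + if a < z then 1 else 0 := by
  unfold cnt
  rw [Finset.filter_insert]
  split_ifs
  · rw [Finset.card_insert_of_notMem (by simp [h])]
  · rfl

theorem cnt_congr {z w : ℕ} {E : Finset ℕ} (h : ∀ v ∈ E, v < z ↔ v < w) : cnt z E = cnt w E := by
  unfold cnt
  rw [Finset.filter_congr h]

theorem cnt_mono {z w : ℕ} (h : z ≤ w) (E : Finset ℕ) : cnt z E ≤ cnt w E :=
  Finset.card_le_card fun v hv => by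
    simp only [Finset.mem_filter] at hv ⊢
    exact ⟨hv.1, hv.2.trans_le h⟩

theorem cnt_le_card (z : ℕ) (E : Finset ℕ) : cnt z E ≤ E.card := Finset.card_filter_le _ _

theorem cnt_eq_card {z : ℕ} {E : Finset ℕ} (h : ∀ v ∈ E, v < z) : cnt z E = E.card := by
  unfold cnt
  rw [Finset.filter_true_of_mem h]

theorem cnt_lt_cnt {z w : ℕ} {E : Finset ℕ} (hz : z ∈ E) (h : z < w) : cnt z E + 1 ≤ cnt w E := by
  have h1 : cnt z E = cnt z (E.erase z) := by
    conv_lhs => rw [← Finset.insert_erase hz, cnt_insert (Finset.notMem_erase z E)]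
    simp
  have h2 : cnt w E = cnt w (E.erase z) + 1 := by
    conv_lhs => rw [← Finset.insert_erase hz, cnt_insert (Finset.notMem_erase z E)]
    simp [h]
  rw [h1, h2]
  exact Nat.succ_le_succ (cnt_mono h.le _)

theorem cnt_filter (z t : ℕ) (E : Finset ℕ) : cnt z (E.filter (· < t)) = cnt (min z t) E := by
  unfold cnt
  rw [Finset.filter_filter]
  congr 1
  ext v
  simp only [Finset.mem_filter, lt_min_iff]
  tauto

/-! ### Tableaux. -/

/-- A sequence of rows, the first row being at index `0`. -/
abbrev Rows := ℕ → Finset ℕ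

namespace Rows

/-- All rows but the first. -/
def tail (T : Rows) : Rows := fun i => T (i + 1)

/-- A new first row on top. -/
def cons (R : Finset ℕ) (T : Rows) : Rows
  | 0 => R
  | i + 1 => T i

theorem ext_tail {T T' : Rows} (h0 : T 0 = T' 0) (h : tail T = tail T') : T = T' := by
  funext i
  rcases i with _ | i
  · exact h0
  · exact congrFun h i

/-- The entries of a sequence of rows. -/
def content (T : Rows) : Set ℕ := {v | ∃ i, v ∈ T i}

theorem mem_content_iff {T : Rows} {v : ℕ} : v ∈ content T ↔ v ∈ T 0 ∨ v ∈ content (tail T) := by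
  constructor
  · rintro ⟨_ | i, h⟩
    · exact Or.inl h
    · exact Or.inr ⟨i, h⟩
  · rintro (h | ⟨i, h⟩)
    · exact ⟨0, h⟩
    · exact ⟨i + 1, h⟩

/-- Sequences of rows which, sorted increasingly and left-justified, form a tableau with strictly
increasing columns and distinct entries. Column strictness is expressed by comparing the numbers of
small entries in consecutive rows. -/
structure IsTab (T : Rows) : Prop where
  dom : ∀ i z, cnt z (T (i + 1)) ≤ cnt z (T i)
  disj : ∀ i j v, v ∈ T i → v ∈ T j → i = j
  fin : ∃ K, ∀ i, K ≤ i → T i = ∅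

theorem isTab_iff {T : Rows} : IsTab T ↔
    IsTab (tail T) ∧ (∀ z, cnt z (tail T 0) ≤ cnt z (T 0)) ∧ ∀ v ∈ T 0, v ∉ content (tail T) := by
  constructor
  · intro h
    refine ⟨⟨fun i z => h.dom (i + 1) z, fun i j v hi hj => ?_, ?_⟩, h.dom 0, ?_⟩
    · have := h.disj (i + 1) (j + 1) v hi hj
      omega
    · obtain ⟨K, hK⟩ := h.fin
      exact ⟨K, fun i hi => hK (i + 1) (by omega)⟩
    · rintro v hv ⟨i, hi⟩
      have := h.disj 0 (i + 1) v hv hi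
      omega
  · rintro ⟨h, h0, hd⟩
    refine ⟨?_, ?_, ?_⟩
    · rintro (_ | i) z
      · exact h0 z
      · exact h.dom i z
    · rintro (_ | i) (_ | j) v hi hj
      · rfl
      · exact (hd v hi ⟨j, hj⟩).elim
      · exact (hd v hj ⟨i, hi⟩).elim
      · rw [h.disj i j v hi hj]
    · obtain ⟨K, hK⟩ := h.fin
      refine ⟨K + 1, ?_⟩
      rintro (_ | i) hi
      · omega
      · exact hK i (by omega)

theorem isTab_empty : IsTab fun _ => ∅ :=
  ⟨fun _ _ => le_rfl, fun _ _ _ h => by simp at h, ⟨0, fun _ _ => rfl⟩⟩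

theorem IsTab.card_succ_le {T : Rows} (h : IsTab T) (i : ℕ) : (T (i + 1)).card ≤ (T i).card := by
  rw [← cnt_eq_card (z := (T (i + 1)).sup id + 1)
    (fun v hv => Nat.lt_succ_of_le (Finset.le_sup (f := id) hv))]
  exact (h.dom i _).trans (cnt_le_card _ _)

theorem IsTab.card_antitone {T : Rows} (h : IsTab T) : Antitone fun i => (T i).card :=
  antitone_nat_of_succ_le h.card_succ_le

theorem IsTab.restrict {T : Rows} (h : IsTab T) (t : ℕ) :
    IsTab fun i => (T i).filter (· < t) := by
  refine ⟨fun i z => ?_, fun i j v hi hj => ?_, ?_⟩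
  · simp only [cnt_filter]
    exact h.dom i _
  · exact h.disj i j v (Finset.mem_filter.1 hi).1 (Finset.mem_filter.1 hj).1
  · obtain ⟨K, hK⟩ := h.fin
    exact ⟨K, fun i hi => by simp [hK i hi]⟩

/-- `T` with `t` added to row `r`. -/
def add (T : Rows) (r t : ℕ) : Rows := Function.update T r (insert t (T r))

theorem mem_add {T : Rows} {r t i v : ℕ} : v ∈ add T r t i ↔ v ∈ T i ∨ (v = t ∧ i = r) := by
  unfold add
  by_cases h : i = r
  · subst h
    simp [or_comm]
  · simp [h]

/-- Counts change only at thresholds above `t`, where they are the full row lengths; so the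
condition on lengths suffices. -/
theorem IsTab.add {T : Rows} (h : IsTab T) {r t : ℕ} (ht : ∀ v ∈ content T, v < t)
    (hr : ∀ i, i + 1 = r → (T r).card < (T i).card) : IsTab (add T r t) := by
  have hlt : ∀ i, ∀ v ∈ T i, v < t := fun i v hv => ht v ⟨i, hv⟩
  have hnm : ∀ i, t ∉ T i := fun i hi => (hlt i t hi).false
  have hc : ∀ i z, cnt z (Rows.add T r t i) = cnt z (T i) + if t < z ∧ i = r then 1 else 0 := by
    intro i z
    unfold Rows.add
    by_cases hi : i = r
    · subst hi
      simp [cnt_insert (hnm i)]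
    · simp [hi]
  refine ⟨fun i z => ?_, fun i j v hi hj => ?_, ?_⟩
  · rw [hc, hc]
    by_cases hz : t < z ∧ i + 1 = r
    · have h1 := hr i hz.2
      rw [cnt_eq_card (fun v hv => (hlt _ v hv).trans hz.1),
        cnt_eq_card (fun v hv => (hlt _ v hv).trans hz.1), if_pos hz, hz.2]
      omega
    · rw [if_neg hz]
      have := h.dom i z
      omega
  · rw [mem_add] at hi hj
    rcases hi with hi | ⟨rfl, rfl⟩ <;> rcases hj with hj | ⟨hj1, rfl⟩
    · exact h.disj i j v hi hj
    · subst hj1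
      exact (hnm _ hi).elim
    · exact (hnm _ hj).elim
    · rfl
  · obtain ⟨K, hK⟩ := h.fin
    refine ⟨max K (r + 1), fun i hi => ?_⟩
    unfold Rows.add
    rw [Function.update_of_ne (by omega), hK i (by omega)]

/-! ### Row insertion and its inverse. -/

/-- The entry `y` of the row `R` is bumped by `x`, giving the row `R'`. -/
def Swap (R : Finset ℕ) (x y : ℕ) (R' : Finset ℕ) : Prop :=
  ∃ E : Finset ℕ, x ∉ E ∧ y ∉ E ∧ x < y ∧ (∀ v ∈ E, v < x ∨ y < v) ∧ R = insert y E ∧ R' = insert x E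

/-- The bumped `y` must be the least entry of `R` above `x`. -/
theorem Swap.det {R R₁ R₂ : Finset ℕ} {x y₁ y₂ : ℕ} (h₁ : Swap R x y₁ R₁) (h₂ : Swap R x y₂ R₂) :
    y₁ = y₂ ∧ R₁ = R₂ := by
  obtain ⟨E, a1, a2, a3, a4, a5, rfl⟩ := h₁
  obtain ⟨F, b1, b2, b3, b4, b5, rfl⟩ := h₂
  have hy : y₁ = y₂ := by
    have m1 : y₁ ∈ insert y₂ F := by rw [← b5, a5]; simp
    have m2 : y₂ ∈ insert y₁ E := by rw [← a5, b5]; simp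
    rcases Finset.mem_insert.1 m1 with m1 | m1
    · exact m1
    · rcases Finset.mem_insert.1 m2 with m2 | m2
      · exact m2.symm
      · have := b4 _ m1
        have := a4 _ m2
        omega
  subst hy
  have hE : E = F := by
    rw [← Finset.erase_insert a2, ← Finset.erase_insert b2, ← a5, ← b5]
  exact ⟨rfl, by rw [hE]⟩

/-- The bumping `x` must be the largest entry of the new row below `y`. -/
theorem Swap.det_rev {R R₁ R₂ : Finset ℕ} {x₁ x₂ y : ℕ} (h₁ : Swap R₁ x₁ y R)
    (h₂ : Swap R₂ x₂ y R) : x₁ = x₂ ∧ R₁ = R₂ := by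
  obtain ⟨E, a1, a2, a3, a4, rfl, a5⟩ := h₁
  obtain ⟨F, b1, b2, b3, b4, rfl, b5⟩ := h₂
  have hy : x₁ = x₂ := by
    have m1 : x₁ ∈ insert x₂ F := by rw [← b5, a5]; simp
    have m2 : x₂ ∈ insert x₁ E := by rw [← a5, b5]; simp
    rcases Finset.mem_insert.1 m1 with m1 | m1
    · exact m1
    · rcases Finset.mem_insert.1 m2 with m2 | m2
      · exact m2.symm
      · have := b4 _ m1
        have := a4 _ m2
        omega
  subst hy
  have hE : E = F := by
    rw [← Finset.erase_insert a1, ← Finset.erase_insert b1, ← a5, ← b5]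
  exact ⟨rfl, by rw [hE]⟩

theorem exists_swap {R : Finset ℕ} {x : ℕ} (hx : x ∉ R) (h : ¬ ∀ v ∈ R, v < x) :
    ∃ y R', y ∈ R ∧ Swap R x y R' := by
  push Not at h
  have hne : (R.filter (x < ·)).Nonempty := by
    obtain ⟨v, hv, hxv⟩ := h
    exact ⟨v, Finset.mem_filter.2 ⟨hv, lt_of_le_of_ne hxv fun e => hx (e ▸ hv)⟩⟩
  have hy := Finset.mem_filter.1 (Finset.min'_mem _ hne)
  refine ⟨_, _, hy.1, R.erase ((R.filter (x < ·)).min' hne), by simp [hx], by simp, hy.2,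
    fun v hv => ?_, by rw [Finset.insert_erase hy.1], rfl⟩
  rw [Finset.mem_erase] at hv
  by_contra! hc
  have h1 : x < v := lt_of_le_of_ne hc.1 fun e => hx (e ▸ hv.2)
  have := Finset.min'_le _ v (Finset.mem_filter.2 ⟨hv.2, h1⟩)
  exact hv.1 (le_antisymm hc.2 this)

theorem exists_swap_rev {R' : Finset ℕ} {y : ℕ} (hy : y ∉ R') (h : ∃ v ∈ R', v < y) :
    ∃ x R, x ∈ R' ∧ Swap R x y R' := by
  have hne : (R'.filter (· < y)).Nonempty := by
    obtain ⟨v, hv, hvy⟩ := h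
    exact ⟨v, Finset.mem_filter.2 ⟨hv, hvy⟩⟩
  have hx := Finset.mem_filter.1 (Finset.max'_mem _ hne)
  refine ⟨_, _, hx.1, R'.erase ((R'.filter (· < y)).max' hne), by simp, by simp [hy], hx.2,
    fun v hv => ?_, rfl, by rw [Finset.insert_erase hx.1]⟩
  rw [Finset.mem_erase] at hv
  by_contra! hc
  have h1 : v ∈ R'.filter (· < y) := by
    rw [Finset.mem_filter]
    exact ⟨hv.2, lt_of_le_of_ne hc.2 fun e => hy (e ▸ hv.2)⟩
  have := Finset.le_max' _ v h1
  exact hv.1 (le_antisymm this hc.1)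

theorem Swap.cnt {R R' : Finset ℕ} {x y : ℕ} (h : Swap R x y R') (z : ℕ) :
    cnt z R' = cnt z R + if x < z ∧ z ≤ y then 1 else 0 := by
  obtain ⟨E, h1, h2, h3, -, rfl, rfl⟩ := h
  rw [cnt_insert h1, cnt_insert h2]
  split_ifs <;> omega

theorem Swap.cnt_eq {R R' : Finset ℕ} {x y z : ℕ} (h : Swap R x y R') (hz : x < z) (hz' : z ≤ y) :
    _root_.cnt z R = _root_.cnt x R := by
  obtain ⟨E, h1, h2, h3, h4, rfl, rfl⟩ := h
  refine cnt_congr fun v hv => ?_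
  rcases Finset.mem_insert.1 hv with rfl | hv
  · omega
  · have := h4 v hv
    omega

/-- `Insert T x T' r`: the row insertion of `x` into `T` gives `T'`, with a new box in row `r`. -/
inductive Insert : Rows → ℕ → Rows → ℕ → Prop
  | append {T T' : Rows} {x : ℕ} (h0 : ∀ v ∈ T 0, v < x) (h1 : T' 0 = insert x (T 0))
      (h2 : tail T' = tail T) : Insert T x T' 0
  | bump {T T' : Rows} {x y r : ℕ} (h : Swap (T 0) x y (T' 0))
      (h' : Insert (tail T) y (tail T') r) : Insert T x T' (r + 1)

namespace Insert

variable {T T' : Rows} {x r : ℕ}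

theorem det {T₁ T₂ : Rows} {r₁ r₂ : ℕ} (h₁ : Insert T x T₁ r₁) (h₂ : Insert T x T₂ r₂) :
    T₁ = T₂ ∧ r₁ = r₂ := by
  induction h₁ generalizing T₂ r₂ with
  | append a0 a1 a2 =>
    cases h₂ with
    | append b0 b1 b2 => exact ⟨ext_tail (a1.trans b1.symm) (a2.trans b2.symm), rfl⟩
    | bump h h' =>
      obtain ⟨E, -, -, h3, -, h5, -⟩ := h
      have := a0 _ (by rw [h5]; exact Finset.mem_insert_self _ _)
      omega
  | bump g g' ih =>
    cases h₂ with
    | append b0 b1 b2 =>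
      obtain ⟨E, -, -, h3, -, h5, -⟩ := g
      have := b0 _ (by rw [h5]; exact Finset.mem_insert_self _ _)
      omega
    | bump h h' =>
      obtain ⟨rfl, h1⟩ := g.det h
      obtain ⟨h2, rfl⟩ := ih h'
      exact ⟨ext_tail h1 h2, rfl⟩

/-- The row of the new box says where to start undoing: there the appended entry is the maximum, and
`Swap.det_rev` recovers each row above. -/
theorem det_rev {T₁ T₂ : Rows} {x₁ x₂ : ℕ} (h₁ : Insert T₁ x₁ T r) (h₂ : Insert T₂ x₂ T r) :
    T₁ = T₂ ∧ x₁ = x₂ := by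
  induction h₁ generalizing T₂ x₂ with
  | append a0 a1 a2 =>
    cases h₂ with
    | append b0 b1 b2 =>
      have hx := a1.symm.trans b1
      rename_i S S' y
      have hxy : y = x₂ := by
        have m1 : y ∈ insert x₂ (T₂ 0) := hx ▸ Finset.mem_insert_self _ _
        have m2 : x₂ ∈ insert y (S 0) := hx ▸ Finset.mem_insert_self _ _
        rcases Finset.mem_insert.1 m1 with m1 | m1
        · exact m1
        · rcases Finset.mem_insert.1 m2 with m2 | m2
          · exact m2.symm
          · have := a0 _ m2
            have := b0 _ m1
            omega
      subst hxy
      refine ⟨ext_tail ?_ (a2.symm.trans b2), rfl⟩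
      rw [← Finset.erase_insert (s := S 0) fun h => (a0 _ h).false, hx,
        Finset.erase_insert fun h => (b0 _ h).false]
  | bump g g' ih =>
    cases h₂ with
    | bump h h' =>
      obtain ⟨h1, rfl⟩ := ih h'
      obtain ⟨rfl, h2⟩ := g.det_rev h
      exact ⟨ext_tail h2 h1, rfl⟩

theorem mem_head (h : Insert T x T' r) : x ∈ T' 0 := by
  cases h with
  | append h0 h1 h2 => simp [h1]
  | bump h h' =>
    obtain ⟨E, -, -, -, -, -, h6⟩ := h
    simp [h6]

theorem mem_content (h : Insert T x T' r) (v : ℕ) :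
    v ∈ content T' ↔ v = x ∨ v ∈ content T := by
  induction h with
  | @append T T' x h0 h1 h2 =>
    rw [mem_content_iff (T := T'), mem_content_iff (T := T), h1, h2, Finset.mem_insert]
    tauto
  | @bump T T' x y r h h' ih =>
    obtain ⟨E, -, -, -, -, h5, h6⟩ := h
    rw [mem_content_iff (T := T'), ih, mem_content_iff (T := T), h5, h6, Finset.mem_insert,
      Finset.mem_insert]
    tauto

theorem cnt_head_of_le (h : Insert T x T' r) {z : ℕ} (hz : z ≤ x) : cnt z (T' 0) = cnt z (T 0) := by
  cases h with
  | append h0 h1 h2 =>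
    rw [h1, cnt_insert fun h => (h0 _ h).false, if_neg (by omega), add_zero]
  | bump h h' => rw [h.cnt, if_neg (by omega), add_zero]

theorem cnt_head_ge (h : Insert T x T' r) (z : ℕ) : cnt z (T 0) ≤ cnt z (T' 0) := by
  cases h with
  | append h0 h1 h2 =>
    rw [h1, cnt_insert fun h => (h0 _ h).false]
    omega
  | bump h h' =>
    rw [h.cnt]
    omega

/-- Applied in `isTab` to the rows below, with `x` the entry bumped into them: it limits the counts
at thresholds beyond that entry. -/
theorem cnt_head_le (h : Insert T x T' r) (z : ℕ) :
    cnt z (T' 0) ≤ max (cnt z (T 0)) (cnt x (T 0) + 1) := by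
  rcases le_or_gt z x with hz | hz
  · rw [h.cnt_head_of_le hz]
    exact le_max_left _ _
  · cases h with
    | append h0 h1 h2 =>
      rw [h1, cnt_insert fun h => (h0 _ h).false, if_pos hz, cnt_eq_card h0]
      exact le_max_of_le_right (Nat.succ_le_succ (cnt_le_card _ _))
    | bump h h' =>
      rw [h.cnt]
      split_ifs with hy
      · rw [h.cnt_eq hz hy.2]
        exact le_max_right _ _
      · exact le_max_left _ _

theorem isTab (h : Insert T x T' r) (hT : IsTab T) (hx : x ∉ content T) : IsTab T' := by
  induction h with
  | append h0 h1 h2 =>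
    obtain ⟨a1, a2, a3⟩ := isTab_iff.1 hT
    rw [mem_content_iff] at hx
    refine isTab_iff.2 ⟨h2 ▸ a1, fun z => ?_, fun v hv => ?_⟩
    · rw [h2, h1, cnt_insert fun h => (h0 _ h).false]
      exact (a2 z).trans (Nat.le_add_right _ _)
    · rw [h2]
      rw [h1, Finset.mem_insert] at hv
      rcases hv with rfl | hv
      · tauto
      · exact a3 v hv
  | @bump T T' x y r h h' ih =>
    obtain ⟨a1, a2, a3⟩ := isTab_iff.1 hT
    have hy : y ∈ T 0 := by
      obtain ⟨E, -, -, -, -, h5, -⟩ := h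
      simp [h5]
    have hxy : x < y := by
      obtain ⟨E, -, -, h3, -⟩ := h
      exact h3
    refine isTab_iff.2 ⟨ih a1 (a3 y hy), fun z => ?_, fun v hv => ?_⟩
    · have h1 := h.cnt z
      have h2 := a2 z
      -- Up to `y` the lower row has not changed and the upper count has not dropped. Beyond `y`,
      -- the upper row of `T` contains `y`, which pays for the extra 1 in `cnt_head_le`.
      rcases le_or_gt z y with hz | hz
      · rw [h'.cnt_head_of_le hz]
        omega
      · have h3 := h'.cnt_head_le z
        have h4 := a2 y
        have h5 := cnt_lt_cnt hy hz
        omega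
    · rw [h'.mem_content]
      rw [mem_content_iff] at hx
      obtain ⟨E, e1, e2, -, -, h5, h6⟩ := h
      rw [h6, Finset.mem_insert] at hv
      rintro (rfl | hc)
      · rcases hv with rfl | hv
        · omega
        · exact e2 hv
      · rcases hv with rfl | hv
        · tauto
        · exact a3 v (by simp [h5, hv]) hc

theorem card (h : Insert T x T' r) (i : ℕ) :
    (T' i).card = (T i).card + if i = r then 1 else 0 := by
  induction h generalizing i with
  | append h0 h1 h2 =>
    rcases i with _ | i
    · rw [h1, Finset.card_insert_of_notMem fun h => (h0 _ h).false]
      simp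
    · have := congrFun h2 i
      simp only [tail] at this
      simp [this]
  | bump h h' ih =>
    rcases i with _ | i
    · obtain ⟨E, h1, h2, -, -, h5, h6⟩ := h
      rw [h5, h6, Finset.card_insert_of_notMem h1, Finset.card_insert_of_notMem h2]
      simp
    · simpa [tail] using ih i

theorem exists_of_isTab (hT : IsTab T) (hx : x ∉ content T) : ∃ T' r, Insert T x T' r := by
  obtain ⟨K, hK⟩ := hT.fin
  induction K generalizing T x with
  | zero =>
    exact ⟨cons {x} (tail T), 0, .append (by simp [hK 0]) (by simp [hK 0, cons]) rfl⟩
  | succ K ih =>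
    by_cases h : ∀ v ∈ T 0, v < x
    · exact ⟨cons (insert x (T 0)) (tail T), 0, .append h rfl rfl⟩
    · obtain ⟨y, R', hy, hs⟩ := exists_swap (fun hc => hx ⟨0, hc⟩) h
      obtain ⟨a1, a2, a3⟩ := isTab_iff.1 hT
      obtain ⟨T₁, r, h1⟩ := ih a1 (a3 y hy) fun i hi => hK (i + 1) (by omega)
      exact ⟨cons R' T₁, r + 1, .bump hs h1⟩

/-- Reverse insertion from the corner in row `r`: remove the maximum of that row, then in each row
above exchange the incoming entry for the largest smaller one. -/
theorem exists_rev (hT' : IsTab T') (hr : (T' (r + 1)).card < (T' r).card) :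
    ∃ T x, Insert T x T' r ∧ IsTab T ∧ x ∉ content T := by
  induction r generalizing T' with
  | zero =>
    obtain ⟨a1, a2, a3⟩ := isTab_iff.1 hT'
    have hne : (T' 0).Nonempty := Finset.card_pos.1 (by omega)
    set x := (T' 0).max' hne with hxdef
    have hx : x ∈ T' 0 := Finset.max'_mem _ hne
    have hlt : ∀ v ∈ (T' 0).erase x, v < x := fun v hv =>
      lt_of_le_of_ne (Finset.le_max' _ v (Finset.mem_of_mem_erase hv)) (Finset.ne_of_mem_erase hv)
    have hins : insert x ((T' 0).erase x) = T' 0 := Finset.insert_erase hx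
    refine ⟨cons ((T' 0).erase x) (tail T'), x, .append hlt hins.symm rfl,
      isTab_iff.2 ⟨a1, fun z => ?_, fun v hv => a3 v (Finset.mem_of_mem_erase hv)⟩, ?_⟩
    · change cnt z (T' 1) ≤ cnt z ((T' 0).erase x)
      have h1 : cnt z (T' 1) ≤ cnt z (T' 0) := a2 z
      rw [← hins, cnt_insert (Finset.notMem_erase _ _)] at h1
      split_ifs at h1 with hz
      · rw [cnt_eq_card fun v hv => (hlt v hv).trans hz, Finset.card_erase_of_mem hx]
        have := cnt_le_card z (T' 1)
        simp only [zero_add] at hr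
        omega
      · exact h1
    · rw [mem_content_iff]
      rintro (h | h)
      · exact (hlt x h).false
      · exact a3 x hx h
  | succ r ih =>
    obtain ⟨a1, a2, a3⟩ := isTab_iff.1 hT'
    obtain ⟨T₁, y, h1, h2, h3⟩ := ih a1 hr
    have hy1 : y ∈ tail T' 0 := h1.mem_head
    have hy0 : y ∉ T' 0 := fun h => a3 y h ⟨0, hy1⟩
    have hys : cnt (y + 1) (T' 0) = cnt y (T' 0) := cnt_congr fun v hv => by
      have : v ≠ y := fun e => hy0 (e ▸ hv)
      omega
    -- Column strictness at threshold `y + 1`: the row below contains `y`, so the row above has an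
    -- entry at most `y`, and it is not `y`.
    have hlow : ∃ v ∈ T' 0, v < y := by
      have g1 := cnt_lt_cnt hy1 (Nat.lt_succ_self y)
      have g2 := a2 (y + 1)
      have : 0 < cnt y (T' 0) := by simp only [Nat.succ_eq_add_one] at g1; omega
      obtain ⟨v, hv⟩ := Finset.card_pos.1 this
      exact ⟨v, (Finset.mem_filter.1 hv).1, (Finset.mem_filter.1 hv).2⟩
    obtain ⟨x, R, hx, hs⟩ := exists_swap_rev hy0 hlow
    refine ⟨cons R T₁, x, .bump hs h1, isTab_iff.2 ⟨h2, fun z => ?_, fun v hv => ?_⟩, ?_⟩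
    · change cnt z (T₁ 0) ≤ cnt z R
      have g1 := hs.cnt z
      have g2 := h1.cnt_head_ge z
      have g3 := a2 z
      split_ifs at g1 with hz
      -- For `x < z ≤ y` the count in `R` is one less than in `T' 0`. The slack comes from comparing
      -- the rows of `T'` at `y + 1`, since `y` lies only in the lower one.
      · have g4 := h1.cnt_head_of_le hz.2
        have g5 := cnt_mono hz.2 (tail T' 0)
        have g6 := cnt_lt_cnt hy1 (Nat.lt_succ_self y)
        have g7 := a2 (y + 1)
        have g8 := hs.cnt_eq hz.1 hz.2
        have g9 := hs.cnt_eq (hz.1.trans_le hz.2) le_rfl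
        have g10 := hs.cnt y
        rw [if_pos ⟨hz.1.trans_le hz.2, le_rfl⟩] at g10
        simp only [Nat.succ_eq_add_one] at g6
        omega
      · omega
    · change v ∉ content T₁
      intro hc
      obtain ⟨E, -, -, -, -, h5, h6⟩ := hs
      change v ∈ R at hv
      rw [h5, Finset.mem_insert] at hv
      rcases hv with rfl | hv
      · exact h3 hc
      · exact a3 v (by simp [h6, hv]) ((h1.mem_content v).2 (Or.inr hc))
    · rw [mem_content_iff]
      rintro (h | h)
      · obtain ⟨E, e1, -, e3, -, h5, -⟩ := hs
        change x ∈ R at h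
        rw [h5, Finset.mem_insert] at h
        rcases h with h | h
        · omega
        · exact e1 h
      · exact a3 x hx ((h1.mem_content x).2 (Or.inr h))

end Insert

/-! ### Reading words and Schensted's theorem. -/

/-- The reading word of the first `K` rows, from the last of them to the first. -/
def read : ℕ → Rows → List ℕ
  | 0, _ => []
  | K + 1, T => read K (tail T) ++ (T 0).sort

theorem sort_eq_of_forall_mem {R : Finset ℕ} {l : List ℕ} (hl : l.Pairwise (· < ·))
    (h : ∀ v, v ∈ R ↔ v ∈ l) : R.sort = l :=
  (Finset.sortedLT_sort R).eq_of_mem_iff hl.sortedLT fun v => by simp [h]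

theorem pairwise_sort_lt (R : Finset ℕ) : R.sort.Pairwise (· < ·) :=
  (Finset.sortedLT_sort R).pairwise

/-- The unchanged entries split into those below `x` and those above `y`, which is the situation of
`WordEquiv.bump`. -/
theorem Swap.wordEquiv {R R' : Finset ℕ} {x y : ℕ} (h : Swap R x y R') :
    WordEquiv (R.sort ++ [x]) (y :: R'.sort) := by
  obtain ⟨E, h1, h2, h3, h4, rfl, rfl⟩ := h
  have hA : ∀ v ∈ (E.filter (· < x)).sort, v < x := fun v hv => by
    simp only [Finset.mem_sort, Finset.mem_filter] at hv
    exact hv.2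
  have hB : ∀ v ∈ (E.filter (y < ·)).sort, y < v := fun v hv => by
    simp only [Finset.mem_sort, Finset.mem_filter] at hv
    exact hv.2
  have hE : ∀ v, v ∈ E ↔ (v ∈ E ∧ v < x) ∨ (v ∈ E ∧ y < v) := fun v =>
    ⟨fun hv => (h4 v hv).imp (fun h => ⟨hv, h⟩) fun h => ⟨hv, h⟩, by tauto⟩
  rw [sort_eq_of_forall_mem (R := insert y E) (pairwise_row (pairwise_sort_lt _)
    (pairwise_sort_lt _) y (fun v hv => (hA v hv).trans h3) hB),
    sort_eq_of_forall_mem (R := insert x E) (pairwise_row (pairwise_sort_lt _)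
    (pairwise_sort_lt _) x hA fun v hv => h3.trans (hB v hv))]
  · exact WordEquiv.bump (pairwise_sort_lt _) (pairwise_sort_lt _) hA h3 hB
  · intro v
    rw [Finset.mem_insert, hE]
    simp only [List.mem_append, List.mem_cons, Finset.mem_sort, Finset.mem_filter]
    tauto
  · intro v
    rw [Finset.mem_insert, hE]
    simp only [List.mem_append, List.mem_cons, Finset.mem_sort, Finset.mem_filter]
    tauto

/-- The first row is read last, so `x` arrives right behind it; the bumped `y` then stands right
behind the remaining rows, where the induction takes over. -/
theorem Insert.wordEquiv {T T' : Rows} {x r : ℕ} (h : Insert T x T' r) {K : ℕ} (hK : r < K) :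
    WordEquiv (read K T ++ [x]) (read K T') := by
  induction h generalizing K with
  | @append T T' x h0 h1 h2 =>
    obtain ⟨K, rfl⟩ := Nat.exists_eq_add_of_lt hK
    simp only [read, zero_add, h1, h2]
    rw [sort_eq_of_forall_mem (R := insert x (T 0)) (l := (T 0).sort ++ [x]), List.append_assoc]
    · exact WordEquiv.refl _
    · exact pairwise_row (pairwise_sort_lt _) List.Pairwise.nil x (by simpa using h0) (by simp)
    · simp [or_comm]
  | @bump T T' x y r h h' ih =>
    obtain ⟨K, rfl⟩ := Nat.exists_eq_add_of_lt (Nat.zero_lt_of_lt hK)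
    rw [zero_add] at hK ⊢
    have h1 := ih (K := K) (by omega)
    simp only [read]
    rw [List.append_assoc]
    refine ((WordEquiv.refl _).append h.wordEquiv).trans ?_
    rw [List.append_cons]
    exact h1.append (WordEquiv.refl _)

theorem read_restrict (K : ℕ) (T : Rows) (t : ℕ) :
    read K (fun i => (T i).filter (· < t)) = (read K T).filter (· < t) := by
  induction K generalizing T with
  | zero => rfl
  | succ K ih =>
    simp only [read, List.filter_append]
    congr 1
    · exact ih (tail T)
    · exact sort_eq_of_forall_mem ((pairwise_sort_lt _).filter _) fun v => by simp

/-- `w` has the increasing and decreasing sublists of the reading word of `T`. -/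
def Represents (w : List ℕ) (T : Rows) : Prop :=
  ∃ K, (∀ i, K ≤ i → T i = ∅) ∧ WordEquiv w (read K T)

theorem Represents.restrict {w : List ℕ} {T : Rows} (h : Represents w T) (t : ℕ) :
    Represents (w.filter (· < t)) fun i => (T i).filter (· < t) := by
  obtain ⟨K, h1, h2⟩ := h
  exact ⟨K, fun i hi => by simp [h1 i hi], by rw [read_restrict]; exact h2.filter_lt t⟩

theorem read_succ_of_empty {K : ℕ} {T : Rows} (h : T K = ∅) : read (K + 1) T = read K T := by
  induction K generalizing T with
  | zero => simp [read, h]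
  | succ K ih =>
    rw [read, ih (T := tail T) h]
    rfl

theorem read_of_le {K L : ℕ} {T : Rows} (h : ∀ i, K ≤ i → T i = ∅) (hL : K ≤ L) :
    read L T = read K T := by
  induction L, hL using Nat.le_induction with
  | base => rfl
  | succ L hL ih => rw [read_succ_of_empty (h L hL), ih]

theorem Represents.insert {w : List ℕ} {T T' : Rows} {x r : ℕ} (h : Represents w T)
    (hi : Insert T x T' r) : Represents (w ++ [x]) T' := by
  obtain ⟨K, h1, h2⟩ := h
  refine ⟨max K (r + 1), fun i hK => ?_, ?_⟩
  · have := hi.card i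
    rw [h1 i (by omega), if_neg (by omega)] at this
    simpa using this
  · refine WordEquiv.trans ?_ (hi.wordEquiv (K := max K (r + 1)) (by omega))
    rw [read_of_le h1 (le_max_left _ _)]
    exact h2.append (WordEquiv.refl _)

/-- Cut the sublist at its first entry `b` from the first row. What precedes `b` is counted by the
first-row entries below `b`, by induction and column strictness; the rest are first-row entries from
`b` on. -/
theorem length_le_cnt {K : ℕ} {T : Rows} (hT : IsTab T) {l : List ℕ} (hl : l.Sublist (read K T))
    (hp : l.Pairwise (· < ·)) {z : ℕ} (hz : ∀ v ∈ l, v < z) : l.length ≤ cnt z (T 0) := by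
  induction K generalizing T l z with
  | zero =>
    have : l = [] := by simpa [read] using hl
    simp [this]
  | succ K ih =>
    obtain ⟨a1, a2, -⟩ := isTab_iff.1 hT
    obtain ⟨l1, l2, rfl, s1, s2⟩ := List.sublist_append_iff.1 hl
    obtain ⟨p1, p2, p3⟩ := List.pairwise_append.1 hp
    rcases l2 with _ | ⟨b, l2⟩
    · simpa using (ih a1 s1 p1 fun v hv => hz v (by simp [hv])).trans (a2 z)
    · have h1 := (ih a1 s1 p1 fun v hv => p3 v hv b (by simp)).trans (a2 b)
      have h2 : (b :: l2).toFinset.card = (b :: l2).length :=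
        List.toFinset_card_of_nodup (p2.imp fun h => h.ne)
      have h3 : cnt b (T 0) + (b :: l2).toFinset.card ≤ cnt z (T 0) := by
        unfold cnt
        rw [← Finset.card_union_of_disjoint]
        · refine Finset.card_le_card fun v hv => ?_
          rw [Finset.mem_union, Finset.mem_filter, List.mem_toFinset] at hv
          rw [Finset.mem_filter]
          rcases hv with hv | hv
          · exact ⟨hv.1, hv.2.trans (hz b (by simp))⟩
          · exact ⟨by simpa using s2.subset hv, hz v (List.mem_append_right _ hv)⟩
        · rw [Finset.disjoint_left]
          intro v hv hv'
          rw [Finset.mem_filter] at hv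
          rw [List.mem_toFinset] at hv'
          rcases List.mem_cons.1 hv' with rfl | hv'
          · exact hv.2.false
          · exact (hv.2.trans (List.rel_of_pairwise_cons p2 hv')).false
      rw [List.length_append]
      omega

theorem hasChain_lt_read {K : ℕ} {T : Rows} (hT : IsTab T) (hK : ∀ i, K ≤ i → T i = ∅) (k : ℕ) :
    HasChain (· < ·) (read K T) k ↔ k ≤ (T 0).card := by
  constructor
  · rintro ⟨l, h1, h2, rfl⟩
    exact (length_le_cnt hT h1 h2 (z := l.sum + 1)
      fun v hv => Nat.lt_succ_of_le (List.le_sum_of_mem hv)).trans (cnt_le_card _ _)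
  · intro hk
    refine ⟨(T 0).sort.take k, ?_, (pairwise_sort_lt _).sublist (List.take_sublist _ _), ?_⟩
    · rw [← read_of_le hK (Nat.le_succ K), read]
      exact (List.take_sublist _ _).trans (List.sublist_append_right _ _)
    · simpa using hk

theorem card_pos_of_sublist_read {K : ℕ} {T : Rows} (hT : IsTab T) {l : List ℕ}
    (hl : l.Sublist (read K T)) (hp : l.Pairwise (· > ·)) : ∀ i < l.length, 0 < (T i).card := by
  induction K generalizing T l with
  | zero =>
    have : l = [] := by simpa [read] using hl
    simp [this]
  | succ K ih =>
    obtain ⟨a1, -, -⟩ := isTab_iff.1 hT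
    obtain ⟨l1, l2, rfl, s1, s2⟩ := List.sublist_append_iff.1 hl
    obtain ⟨p1, p2, p3⟩ := List.pairwise_append.1 hp
    have h1 := ih a1 s1 p1
    intro i hi
    rcases length_le_one_of_pairwise ((pairwise_sort_lt _).sublist s2) p2 with rfl | ⟨v, rfl⟩
    · exact (h1 i (by simpa using hi)).trans_le (hT.card_succ_le i)
    · rcases i with _ | i
      · exact Finset.card_pos.2 ⟨v, by simpa using s2⟩
      · exact h1 i (by simpa using hi)

/-- The row minima, that is, the first column. The last clause lets the induction place a smaller
minimum behind the sublist. -/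
theorem exists_decreasing_sublist_read {K k : ℕ} {T : Rows} (hT : IsTab T)
    (hK : ∀ i, K ≤ i → T i = ∅) (hk : ∀ i < k, 0 < (T i).card) :
    ∃ l : List ℕ, l.Sublist (read K T) ∧ l.Pairwise (· > ·) ∧ l.length = k ∧
      ∀ v ∈ l, ∃ a ∈ T 0, a ≤ v := by
  induction K generalizing T k with
  | zero =>
    rcases k with _ | k
    · exact ⟨[], by simp, by simp, rfl, by simp⟩
    · have := hk 0 (by omega)
      simp [hK 0] at this
  | succ K ih =>
    rcases k with _ | k
    · exact ⟨[], by simp, by simp, rfl, by simp⟩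
    · obtain ⟨a1, a2, a3⟩ := isTab_iff.1 hT
      obtain ⟨l, h1, h2, h3, h4⟩ := ih (k := k) a1 (fun i hi => hK (i + 1) (by omega))
        fun i hi => hk (i + 1) (by omega)
      have hne : (T 0).Nonempty := Finset.card_pos.1 (hk 0 (by omega))
      have hlt : ∀ v ∈ l, (T 0).min' hne < v := by
        intro v hv
        obtain ⟨a, ha, hav⟩ := h4 v hv
        have g1 := cnt_lt_cnt ha (Nat.lt_succ_self a)
        have g2 := a2 (a + 1)
        have : 0 < cnt (a + 1) (T 0) := by simp only [Nat.succ_eq_add_one] at g1; omega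
        obtain ⟨b, hb⟩ := Finset.card_pos.1 this
        obtain ⟨hb, hba⟩ := Finset.mem_filter.1 hb
        have hab : b ≠ a := fun e => a3 b hb ⟨0, e ▸ ha⟩
        have := Finset.min'_le _ b hb
        omega
      have hm := Finset.min'_mem _ hne
      refine ⟨l ++ [(T 0).min' hne], h1.append (by simpa using hm), ?_, by simp [h3], ?_⟩
      · rw [List.pairwise_append]
        exact ⟨h2, by simp, by simpa using hlt⟩
      · intro v hv
        rcases List.mem_append.1 hv with hv | hv
        · exact ⟨_, hm, (hlt v hv).le⟩
        · exact ⟨_, hm, by simp at hv; omega⟩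

theorem Represents.hasChain_lt {w : List ℕ} {T : Rows} (h : Represents w T) (hT : IsTab T)
    (k : ℕ) : HasChain (· < ·) w k ↔ k ≤ (T 0).card := by
  obtain ⟨K, h1, h2⟩ := h
  rw [h2.hasChain_lt, hasChain_lt_read hT h1]

theorem Represents.hasChain_gt {w : List ℕ} {T : Rows} (h : Represents w T) (hT : IsTab T)
    (k : ℕ) : HasChain (· > ·) w k ↔ ∀ i < k, 0 < (T i).card := by
  obtain ⟨K, h1, h2⟩ := h
  rw [h2.hasChain_gt]
  constructor
  · rintro ⟨l, h1, h2, rfl⟩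
    exact card_pos_of_sublist_read hT h1 h2
  · intro hk
    obtain ⟨l, g1, g2, g3, -⟩ := exists_decreasing_sublist_read hT h1 hk
    exact ⟨l, g1, g2, g3⟩

/-! ### Conjugate shapes. -/

/-- The shapes of `T` and `T'` are conjugate partitions. -/
def Conj (T T' : Rows) : Prop := ∀ i j, j < (T i).card ↔ i < (T' j).card

theorem Conj.symm {T T' : Rows} (h : Conj T T') : Conj T' T := fun i j => (h j i).symm

theorem Conj.hasChain {T T' : Rows} (h : Conj T T') (hT : IsTab T) (hT' : IsTab T')
    {w w' : List ℕ} (hw : Represents w T) (hw' : Represents w' T') (k : ℕ) :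
    HasChain (· > ·) w k ↔ HasChain (· < ·) w' k := by
  rw [hw.hasChain_gt hT, hw'.hasChain_lt hT']
  simp only [h _ 0]
  refine ⟨fun H => ?_, fun H i hi => hi.trans_le H⟩
  by_contra hc
  exact (H _ (not_le.1 hc)).false

end Rows

namespace Rows

theorem Conj.card_eq {T T₁ T₂ : Rows} (h₁ : Conj T T₁) (h₂ : Conj T T₂) (j : ℕ) :
    (T₁ j).card = (T₂ j).card := by
  have h : ∀ i, i < (T₁ j).card ↔ i < (T₂ j).card := fun i => (h₁ i j).symm.trans (h₂ i j)
  have h1 := h (T₁ j).card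
  have h2 := h (T₂ j).card
  omega

/-- If the shape of `S` is that of `U` plus a box in row `r`, then the shape of `U'` conjugate to
`U` has `r` boxes in the row of the conjugate position, and adding a box there gives the conjugate
of `S`. -/
theorem Conj.add_box {U U' S : Rows} {r : ℕ} (hU : IsTab U) (hS : IsTab S) (h : Conj U U')
    (hc : ∀ i, (S i).card = (U i).card + if i = r then 1 else 0) :
    (U' (U r).card).card = r ∧ (∀ i, i + 1 = (U r).card → r < (U' i).card) ∧
      ∀ S' : Rows, (∀ j, (S' j).card = (U' j).card + if j = (U r).card then 1 else 0) →
        Conj S S' := by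
  have hk : (U' (U r).card).card = r := by
    -- Rows of `U` above `r` are strictly longer than row `r`, because `S` with its extra box is
    -- still a tableau.
    have key : ∀ j, j < (U' (U r).card).card ↔ j < r := by
      intro j
      rw [← h j]
      rcases lt_or_ge j r with hj | hj
      · have h1 : (S r).card ≤ (S j).card := hS.card_antitone hj.le
        rw [hc, hc, if_pos rfl, if_neg hj.ne] at h1
        omega
      · have h1 : (U j).card ≤ (U r).card := hU.card_antitone hj
        omega
    have h1 := key r
    have h2 := key (U' (U r).card).card
    omega
  refine ⟨hk, fun i hi => (h r i).1 (by omega), fun S' hS' i j => ?_⟩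
  rw [hc, hS']
  have h1 := h i j
  by_cases hi : i = r
  · subst hi
    by_cases hj : j = (U i).card
    · subst hj
      simp [hk]
    · simp only [if_true, if_neg hj]
      omega
  · by_cases hj : j = (U r).card
    · subst hj
      simp only [if_true, if_neg hi]
      omega
    · simp only [if_neg hi, if_neg hj]
      omega

/-- If the shape of `S` is that of `U` minus a box in row `r`, then the shape of `U'` conjugate to
`U` has a corner at the conjugate position, and removing it gives the conjugate of `S`. -/
theorem Conj.remove_box {U U' S : Rows} {r : ℕ} (hU : IsTab U) (hS : IsTab S) (h : Conj U U')
    (hc : ∀ i, (U i).card = (S i).card + if i = r then 1 else 0) :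
    (U' ((S r).card + 1)).card < (U' (S r).card).card ∧
      ∀ S' : Rows, (∀ j, (U' j).card = (S' j).card + if j = (S r).card then 1 else 0) →
        Conj S S' := by
  have hr : (U r).card = (S r).card + 1 := by simp [hc]
  have hk : (U' (S r).card).card = r + 1 := by
    have key : ∀ j, j < (U' (S r).card).card ↔ j < r + 1 := by
      intro j
      rw [← h j]
      rcases lt_or_ge r j with hj | hj
      · have h1 : (S j).card ≤ (S r).card := hS.card_antitone hj.le
        have h2 := hc j
        rw [if_neg hj.ne'] at h2
        omega
      · have h1 : (U r).card ≤ (U j).card := hU.card_antitone hj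
        omega
    have h1 := key (r + 1)
    have h2 := key (U' (S r).card).card
    omega
  refine ⟨?_, fun S' hS' i j => ?_⟩
  · have := h r ((S r).card + 1)
    omega
  · have h1 := h i j
    have h2 := hc i
    have h3 := hS' j
    by_cases hi : i = r
    · subst hi
      by_cases hj : j = (S i).card
      · subst hj
        simp only [if_true] at h2 h3
        omega
      · simp only [if_true, if_neg hj] at h2 h3
        omega
    · by_cases hj : j = (S r).card
      · subst hj
        simp only [if_true, if_neg hi] at h2 h3
        omega
      · simp only [if_neg hi, if_neg hj] at h2 h3
        omega

end Rows

theorem card_eq_card_filter_lt {R : Finset ℕ} {t : ℕ} (h : ∀ v ∈ R, v < t + 1) :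
    R.card = (R.filter (· < t)).card + if t ∈ R then 1 else 0 := by
  have h1 := cnt_eq_card h
  by_cases ht : t ∈ R
  · have h2 := cnt_lt_cnt ht (Nat.lt_succ_self t)
    have h3 : R ⊆ insert t (R.filter (· < t)) := fun v hv => by
      have := h v hv
      rw [Finset.mem_insert, Finset.mem_filter]
      rcases Nat.lt_succ_iff_lt_or_eq.1 this with hvt | hvt
      · exact Or.inr ⟨hv, hvt⟩
      · exact Or.inl hvt
    have h4 := (Finset.card_le_card h3).trans (Finset.card_insert_le _ _)
    rw [if_pos ht]
    simp only [cnt, Nat.succ_eq_add_one] at h1 h2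
    omega
  · rw [if_neg ht, Finset.filter_true_of_mem]
    · rfl
    · exact fun v hv => lt_of_le_of_ne (Nat.lt_succ_iff.1 (h v hv)) fun e => ht (e ▸ hv)

theorem eq_of_filter_lt_eq {R R' : Finset ℕ} {t : ℕ} (h : ∀ v ∈ R, v < t + 1)
    (h' : ∀ v ∈ R', v < t + 1) (hf : R.filter (· < t) = R'.filter (· < t))
    (hc : R.card = R'.card) : R = R' := by
  have ht : t ∈ R ↔ t ∈ R' := by
    rw [card_eq_card_filter_lt h, card_eq_card_filter_lt h', hf] at hc
    by_cases h1 : t ∈ R <;> by_cases h2 : t ∈ R' <;> simp_all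
  ext v
  by_cases hv : v < t
  · have := Finset.ext_iff.1 hf v
    simpa [hv] using this
  · rcases eq_or_ne v t with rfl | hne
    · exact ht
    · exact ⟨fun hR => by have := h v hR; omega, fun hR => by have := h' v hR; omega⟩

/-! ### States at a cut and the steps between them. -/

/-- The vertex `v` is an endpoint of `a`. -/
def ColoredArc.IsEnd {n m : ℕ} (a : ColoredArc n m) (v : ℕ) : Prop :=
  (a.left : ℕ) = v ∨ (a.right : ℕ) = v

/-- A set of arcs to the left of a cut, and for each color a tableau formed by the left endpoints
of the arcs that cross the cut. -/
@[ext]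
structure CutState (n m : ℕ) where
  arcs : Set (ColoredArc n m)
  tab : Fin m → Rows

namespace CutState

open Rows

variable {n m : ℕ}

/-- Each of the first `t` vertices occurs exactly once, in an arc or in a tableau, and there is
nothing else. -/
structure Good (t : ℕ) (s : CutState n m) : Prop where
  right_lt : ∀ a ∈ s.arcs, (a.right : ℕ) < t
  content_lt : ∀ c, ∀ v ∈ content (s.tab c), v < t
  cover : ∀ v < t, (∃ a ∈ s.arcs, a.IsEnd v) ∨ ∃ c, v ∈ content (s.tab c)
  arcs_disj : ∀ a ∈ s.arcs, ∀ b ∈ s.arcs, ∀ v, a.IsEnd v → b.IsEnd v → a = b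
  not_both : ∀ a ∈ s.arcs, ∀ v, a.IsEnd v → ∀ c, v ∉ content (s.tab c)
  color_disj : ∀ v c d, v ∈ content (s.tab c) → v ∈ content (s.tab d) → c = d
  isTab : ∀ c, IsTab (s.tab c)

/-- Vertex `t`, of color `c`, starts an arc: it appears in the tableau of color `c`. -/
def Open (t : ℕ) (c : Fin m) (u s : CutState n m) : Prop :=
  s.arcs = u.arcs ∧ t ∈ content (s.tab c) ∧
    ∀ d, u.tab d = fun i => (s.tab d i).filter (· < t)

/-- Vertex `t`, of color `c`, ends an arc, whose left endpoint leaves the tableau of color `c`. -/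
def Close (t : ℕ) (c : Fin m) (u s : CutState n m) : Prop :=
  ∃ a r, (a.right : ℕ) = t ∧ a.color = c ∧ s.arcs = insert a u.arcs ∧
    (∀ d, d ≠ c → u.tab d = s.tab d) ∧ Insert (s.tab c) a.left (u.tab c) r

theorem content_restrict (T : Rows) (t v : ℕ) :
    v ∈ content (fun i => (T i).filter (· < t)) ↔ v ∈ content T ∧ v < t := by
  simp only [content, Set.mem_ofPred_eq, Finset.mem_filter]
  constructor
  · rintro ⟨i, h1, h2⟩
    exact ⟨⟨i, h1⟩, h2⟩
  · rintro ⟨⟨i, h1⟩, h2⟩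
    exact ⟨i, h1, h2⟩

theorem Open.mem_content {t : ℕ} {c : Fin m} {u s : CutState n m} (h : Open t c u s) (d : Fin m)
    (v : ℕ) : v ∈ content (u.tab d) ↔ v ∈ content (s.tab d) ∧ v < t := by
  rw [h.2.2 d, content_restrict]

theorem Open.good {t : ℕ} {c : Fin m} {u s : CutState n m} (h : Open t c u s)
    (hs : Good (t + 1) s) : Good t u := by
  refine ⟨fun a ha => ?_, fun d v hv => ((h.mem_content d v).1 hv).2, fun v hv => ?_, ?_,
    fun a ha v hv d hc => ?_, fun v d e hd he => ?_, fun d => ?_⟩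
  · rw [← h.1] at ha
    have h1 := hs.right_lt a ha
    have h2 : (a.right : ℕ) ≠ t := fun e => hs.not_both a ha t (Or.inr e) c h.2.1
    omega
  · rw [← h.1]
    exact (hs.cover v (by omega)).imp id fun ⟨d, hd⟩ => ⟨d, (h.mem_content d v).2 ⟨hd, hv⟩⟩
  · rw [← h.1]
    exact hs.arcs_disj
  · rw [← h.1] at ha
    exact hs.not_both a ha v hv d ((h.mem_content d v).1 hc).1
  · exact hs.color_disj v d e ((h.mem_content d v).1 hd).1 ((h.mem_content e v).1 he).1
  · rw [h.2.2 d]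
    exact (hs.isTab d).restrict t

/-- Every good state is reached by a step. -/
theorem Good.exists_prev {t : ℕ} {s : CutState n m} (hs : Good (t + 1) s) :
    ∃ u c, Good t u ∧ (Open t c u s ∨ Close t c u s) := by
  rcases hs.cover t (Nat.lt_succ_self t) with ⟨a, ha, hat⟩ | ⟨c, hc⟩
  · have hlr : (a.left : ℕ) < a.right := a.left_lt_right
    have hr := hs.right_lt a ha
    have hat : (a.right : ℕ) = t := by
      rcases hat with h | h <;> omega
    have hx : ∀ d, (a.left : ℕ) ∉ content (s.tab d) := hs.not_both a ha _ (Or.inl rfl)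
    have ht : ∀ d, t ∉ content (s.tab d) := hs.not_both a ha _ (Or.inr hat)
    obtain ⟨T, r, hT⟩ := Insert.exists_of_isTab (hs.isTab a.color) (hx _)
    have hm : ∀ d v, v ∈ content (Function.update s.tab a.color T d) ↔
        v ∈ content (s.tab d) ∨ (v = a.left ∧ d = a.color) := by
      intro d v
      by_cases hd : d = a.color
      · subst hd
        rw [Function.update_self, hT.mem_content]
        tauto
      · rw [Function.update_of_ne hd]
        tauto
    refine ⟨⟨s.arcs \ {a}, Function.update s.tab a.color T⟩, a.color, ?_, Or.inr ⟨a, r, hat, rfl,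
      ?_, fun d hd => Function.update_of_ne hd _ _, by simpa using hT⟩⟩
    · refine ⟨fun b hb => ?_, fun d v hv => ?_, fun v hv => ?_,
        fun b hb b' hb' => hs.arcs_disj b hb.1 b' hb'.1, fun b hb v hv d hc => ?_,
        fun v d e hd he => ?_, fun d => ?_⟩
      · have h1 := hs.right_lt b hb.1
        have h2 : (b.right : ℕ) ≠ t := fun e =>
          hb.2 (hs.arcs_disj b hb.1 a ha t (Or.inr e) (Or.inr hat))
        omega
      · rcases (hm d v).1 hv with h | ⟨rfl, -⟩
        · have h1 := hs.content_lt d v h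
          have h2 : v ≠ t := fun e => ht d (e ▸ h)
          omega
        · omega
      · rcases hs.cover v (by omega) with ⟨b, hb, hbv⟩ | ⟨d, hd⟩
        · by_cases hba : b = a
          · subst hba
            refine Or.inr ⟨b.color, (hm _ _).2 (Or.inr ⟨?_, rfl⟩)⟩
            rcases hbv with h | h <;> omega
          · exact Or.inl ⟨b, ⟨hb, hba⟩, hbv⟩
        · exact Or.inr ⟨d, (hm d v).2 (Or.inl hd)⟩
      · rcases (hm d v).1 hc with h | ⟨rfl, -⟩
        · exact hs.not_both b hb.1 v hv d h
        · exact hb.2 (hs.arcs_disj b hb.1 a ha _ hv (Or.inl rfl))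
      · rcases (hm d v).1 hd with h | ⟨h0, rfl⟩ <;> rcases (hm e v).1 he with h' | ⟨h1, rfl⟩
        · exact hs.color_disj v d e h h'
        · exact (hx d (h1 ▸ h)).elim
        · exact (hx e (h0 ▸ h')).elim
        · rfl
      · by_cases hd : d = a.color
        · subst hd
          simpa using hT.isTab (hs.isTab _) (hx _)
        · simpa [Function.update_of_ne hd] using hs.isTab d
    · rw [Set.insert_sdiff_singleton, Set.insert_eq_of_mem ha]
  · have h : Open t c ⟨s.arcs, fun d i => (s.tab d i).filter (· < t)⟩ s := ⟨rfl, hc, fun _ => rfl⟩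
    exact ⟨_, c, h.good hs, Or.inl h⟩

theorem Close.content_lt {t : ℕ} {c : Fin m} {u s : CutState n m} (h : Close t c u s)
    (hu : Good t u) (d : Fin m) : ∀ v ∈ content (s.tab d), v < t := by
  obtain ⟨a, r, -, -, -, h1, h2⟩ := h
  intro v hv
  by_cases hd : d = c
  · subst hd
    exact hu.content_lt d v ((h2.mem_content v).2 (Or.inr hv))
  · exact hu.content_lt d v (by rwa [h1 d hd])

theorem Open.prev_unique {t : ℕ} {c d : Fin m} {u v s : CutState n m} (h : Open t c u s)
    (h' : Open t d v s) : u = v :=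
  CutState.ext (h.1.symm.trans h'.1) (funext fun e => (h.2.2 e).trans (h'.2.2 e).symm)

theorem Close.prev_unique {t : ℕ} {c d : Fin m} {u v s : CutState n m} (h : Close t c u s)
    (h' : Close t d v s) (hu : Good t u) (hv : Good t v) : u = v ∧ c = d := by
  obtain ⟨a, r, a1, rfl, a3, a4, a5⟩ := h
  obtain ⟨b, r', b1, rfl, b3, b4, b5⟩ := h'
  have hau : a ∉ u.arcs := fun h => by
    have := hu.right_lt a h
    omega
  have hbv : b ∉ v.arcs := fun h => by
    have := hv.right_lt b h
    omega
  have hins := a3.symm.trans b3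
  have hab : a = b := by
    have h1 : a ∈ insert b v.arcs := hins ▸ Set.mem_insert _ _
    rcases h1 with h1 | h1
    · exact h1
    · have := hv.right_lt a h1
      omega
  subst hab
  refine ⟨CutState.ext ?_ (funext fun e => ?_), rfl⟩
  · rw [← Set.insert_sdiff_self_of_notMem hau, hins, Set.insert_sdiff_self_of_notMem hbv]
  · by_cases he : e = a.color
    · subst he
      exact (a5.det b5).1
    · rw [a4 e he, b4 e he]

/-- The entry `t` must sit in the row where the prescribed shape exceeds the shape of `u`. -/
theorem Open.next_unique {t : ℕ} {c d : Fin m} {u s s' : CutState n m} (h : Open t c u s)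
    (h' : Open t d u s') (hs : Good (t + 1) s) (hs' : Good (t + 1) s')
    (hc : ∀ e i, (s.tab e i).card = (s'.tab e i).card) : s = s' := by
  refine CutState.ext (h.1.trans h'.1.symm) (funext fun e => funext fun i => ?_)
  have hf : (s.tab e i).filter (· < t) = (s'.tab e i).filter (· < t) :=
    congrFun ((h.2.2 e).symm.trans (h'.2.2 e)) i
  exact eq_of_filter_lt_eq (fun v hv => hs.content_lt e v ⟨i, hv⟩)
    (fun v hv => hs'.content_lt e v ⟨i, hv⟩) hf (hc e i)

/-- The shapes fix the row of the box that vanishes, and then reverse insertion fixes the expelled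
entry, hence the arc. -/
theorem Close.next_unique {t : ℕ} {c : Fin m} {u s s' : CutState n m} (h : Close t c u s)
    (h' : Close t c u s') (hc : ∀ e i, (s.tab e i).card = (s'.tab e i).card) : s = s' := by
  obtain ⟨a, r, a1, rfl, a3, a4, a5⟩ := h
  obtain ⟨b, r', b1, b2, b3, b4, b5⟩ := h'
  have hr : r = r' := by
    have h1 := a5.card r
    have h2 := b5.card r
    have h3 := hc a.color r
    rw [if_pos rfl] at h1
    by_contra hne
    rw [if_neg hne] at h2
    omega
  subst hr
  obtain ⟨h1, h2⟩ := a5.det_rev b5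
  have hab : a = b := ColoredArc.ext (Fin.ext h2) (Fin.ext (a1.trans b1.symm)) b2.symm
  subst hab
  refine CutState.ext (a3.trans b3.symm) (funext fun e => ?_)
  by_cases he : e = a.color
  · rw [he, h1]
  · rw [← a4 e he, ← b4 e he]

/-- The new box lies in row `r` and column `(u.tab c r).card`. The transposed step puts `t`, larger
than all entries of `u'`, at the end of the row with that column's index. -/
theorem Open.exists_conj {t : ℕ} {c : Fin m} {u u' s : CutState n m} (h : Open t c u s)
    (hu : Good t u) (hu' : Good t u') (hs : Good (t + 1) s)
    (hc : ∀ d, Conj (u.tab d) (u'.tab d)) :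
    ∃ s', Good (t + 1) s' ∧ Open t c u' s' ∧ ∀ d, Conj (s.tab d) (s'.tab d) := by
  obtain ⟨r, hr⟩ := h.2.1
  have hcard : ∀ d i, (s.tab d i).card = (u.tab d i).card + if d = c ∧ i = r then 1 else 0 := by
    intro d i
    have h1 := card_eq_card_filter_lt (R := s.tab d i) (t := t) fun v hv =>
      hs.content_lt d v ⟨i, hv⟩
    rw [h1, h.2.2 d]
    have h2 : t ∈ s.tab d i ↔ d = c ∧ i = r := by
      constructor
      · intro ht
        have h3 := hs.color_disj t d c ⟨i, ht⟩ ⟨r, hr⟩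
        subst h3
        exact ⟨rfl, (hs.isTab d).disj i r t ht hr⟩
      · rintro ⟨rfl, rfl⟩
        exact hr
    simp only [h2]
  obtain ⟨h1, h2, h3⟩ := (hc c).add_box (hu.isTab c) (hs.isTab c) (r := r) fun i => by
    simpa using hcard c i
  have htn : ∀ d, t ∉ content (u'.tab d) := fun d hd => (hu'.content_lt d t hd).false
  have hm : ∀ d i v, v ∈ Function.update u'.tab c (add (u'.tab c) (u.tab c r).card t) d i ↔
      v ∈ u'.tab d i ∨ (v = t ∧ d = c ∧ i = (u.tab c r).card) := by
    intro d i v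
    by_cases hd : d = c
    · subst hd
      rw [Function.update_self, mem_add]
      tauto
    · rw [Function.update_of_ne hd]
      tauto
  have hm' : ∀ d v, v ∈ content (Function.update u'.tab c (add (u'.tab c) (u.tab c r).card t) d) ↔
      v ∈ content (u'.tab d) ∨ (v = t ∧ d = c) := by
    intro d v
    constructor
    · rintro ⟨i, hi⟩
      exact ((hm d i v).1 hi).imp (fun h => ⟨i, h⟩) fun h => ⟨h.1, h.2.1⟩
    · rintro (⟨i, hi⟩ | ⟨h, h'⟩)
      · exact ⟨i, (hm d i v).2 (Or.inl hi)⟩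
      · exact ⟨_, (hm d _ v).2 (Or.inr ⟨h, h', rfl⟩)⟩
  refine ⟨⟨u'.arcs, Function.update u'.tab c (add (u'.tab c) (u.tab c r).card t)⟩,
    ⟨fun a ha => (hu'.right_lt a ha).trans (Nat.lt_succ_self t), fun d v hv => ?_,
      fun v hv => ?_, hu'.arcs_disj, fun a ha v hv d hd => ?_, fun v d e hd he => ?_,
      fun d => ?_⟩, ⟨rfl, (hm' c t).2 (Or.inr ⟨rfl, rfl⟩), fun d => ?_⟩, fun d => ?_⟩
  · rcases (hm' d v).1 hv with h | ⟨rfl, -⟩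
    · exact (hu'.content_lt d v h).trans (Nat.lt_succ_self t)
    · exact Nat.lt_succ_self v
  · rcases Nat.lt_succ_iff_lt_or_eq.1 hv with hv | rfl
    · exact (hu'.cover v hv).imp id fun ⟨d, hd⟩ => ⟨d, (hm' d v).2 (Or.inl hd)⟩
    · exact Or.inr ⟨c, (hm' c v).2 (Or.inr ⟨rfl, rfl⟩)⟩
  · rcases (hm' d v).1 hd with h | ⟨rfl, -⟩
    · exact hu'.not_both a ha v hv d h
    · have h1 : (a.left : ℕ) < a.right := a.left_lt_right
      have h2 := hu'.right_lt a ha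
      rcases hv with hv | hv <;> omega
  · rcases (hm' d v).1 hd with hp | ⟨h0, rfl⟩ <;> rcases (hm' e v).1 he with h' | ⟨hq, rfl⟩
    · exact hu'.color_disj v d e hp h'
    · exact (htn d (hq ▸ hp)).elim
    · exact (htn e (h0 ▸ h')).elim
    · rfl
  · by_cases hd : d = c
    · subst hd
      simp only [Function.update_self]
      refine (hu'.isTab d).add (hu'.content_lt d) fun i hi => ?_
      rw [h1]
      exact h2 i hi
    · simpa only [Function.update_of_ne hd] using hu'.isTab d
  · funext i
    ext v
    rw [Finset.mem_filter]
    simp only [hm]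
    constructor
    · exact fun hv => ⟨Or.inl hv, hu'.content_lt d v ⟨i, hv⟩⟩
    · rintro ⟨hv | ⟨rfl, -⟩, hvt⟩
      · exact hv
      · exact (hvt.false).elim
  · by_cases hd : d = c
    · subst hd
      simp only [Function.update_self]
      refine h3 _ fun j => ?_
      unfold add
      by_cases hj : j = (u.tab d r).card
      · rw [hj, Function.update_self, Finset.card_insert_of_notMem fun h => htn d ⟨_, h⟩,
          if_pos rfl]
      · rw [Function.update_of_ne hj, if_neg hj, add_zero]
    · simp only [Function.update_of_ne hd]
      intro i j
      have := hcard d i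
      rw [if_neg fun h => hd h.1] at this
      rw [this]
      exact hc d i j

/-- The vanishing box corresponds to a corner of the transposed shape. Reverse insertion there
expels some `x`, and the arc from `x` to `t` is the one to close. -/
theorem Close.exists_conj {t : ℕ} {c : Fin m} {u u' s : CutState n m} (h : Close t c u s)
    (ht : t < 2 * n) (hu : Good t u) (hu' : Good t u') (hs : Good (t + 1) s)
    (hc : ∀ d, Conj (u.tab d) (u'.tab d)) :
    ∃ s', Good (t + 1) s' ∧ Close t c u' s' ∧ ∀ d, Conj (s.tab d) (s'.tab d) := by
  obtain ⟨a, r, a1, a2, a3, a4, a5⟩ := h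
  obtain ⟨h1, h2⟩ := (hc c).remove_box (hu.isTab c) (hs.isTab c) a5.card
  obtain ⟨T, x, hT, hT1, hx⟩ := Insert.exists_rev (hu'.isTab c) h1
  have hxc : x ∈ content (u'.tab c) := (hT.mem_content x).2 (Or.inl rfl)
  have hxt := hu'.content_lt c x hxc
  have hm : ∀ d v, v ∈ content (Function.update u'.tab c T d) ↔
      v ∈ content (u'.tab d) ∧ v ≠ x := by
    intro d v
    by_cases hd : d = c
    · subst hd
      rw [Function.update_self, hT.mem_content]
      constructor
      · exact fun h => ⟨Or.inr h, fun e => hx (e ▸ h)⟩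
      · tauto
    · rw [Function.update_of_ne hd]
      constructor
      · exact fun h => ⟨h, fun e => hd (hu'.color_disj x d c (e ▸ h) hxc)⟩
      · tauto
  let b : ColoredArc n m := ⟨⟨x, by omega⟩, ⟨t, ht⟩, hxt, c⟩
  have hb : ∀ a' ∈ u'.arcs, ∀ v, a'.IsEnd v → ¬ b.IsEnd v := by
    rintro a' ha' v hv (hbv | hbv)
    · exact hu'.not_both a' ha' v hv c (hbv ▸ hxc)
    · have h1 : (a'.left : ℕ) < a'.right := a'.left_lt_right
      have h2 := hu'.right_lt a' ha'
      change t = v at hbv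
      rcases hv with hv | hv <;> omega
  refine ⟨⟨insert b u'.arcs, Function.update u'.tab c T⟩, ⟨?_, fun d v hv => ?_, fun v hv => ?_,
    ?_, ?_, fun v d e hd he => ?_, fun d => ?_⟩,
    ⟨b, _, rfl, rfl, rfl, fun d hd => ?_, by simpa using hT⟩, fun d => ?_⟩
  · rintro a' (rfl | ha')
    · exact Nat.lt_succ_self t
    · exact (hu'.right_lt a' ha').trans (Nat.lt_succ_self t)
  · exact (hu'.content_lt d v ((hm d v).1 hv).1).trans (Nat.lt_succ_self t)
  · by_cases hbv : b.IsEnd v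
    · exact Or.inl ⟨b, Set.mem_insert _ _, hbv⟩
    · have hvt : v ≠ t := fun e => hbv (Or.inr e.symm)
      have hvx : v ≠ x := fun e => hbv (Or.inl e.symm)
      rcases hu'.cover v (by omega) with ⟨a', ha', h⟩ | ⟨d, hd⟩
      · exact Or.inl ⟨a', Set.mem_insert_of_mem _ ha', h⟩
      · exact Or.inr ⟨d, (hm d v).2 ⟨hd, hvx⟩⟩
  · rintro a₁ (rfl | h₁) a₂ (rfl | h₂) v hv₁ hv₂
    · rfl
    · exact (hb a₂ h₂ v hv₂ hv₁).elim
    · exact (hb a₁ h₁ v hv₁ hv₂).elim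
    · exact hu'.arcs_disj a₁ h₁ a₂ h₂ v hv₁ hv₂
  · rintro a' (rfl | ha') v hv d hd
    · rw [hm] at hd
      rcases hv with hv | hv
      · exact hd.2 hv.symm
      · change t = v at hv
        exact (hu'.content_lt d v hd.1).ne hv.symm
    · exact hu'.not_both a' ha' v hv d ((hm d v).1 hd).1
  · exact hu'.color_disj v d e ((hm d v).1 hd).1 ((hm e v).1 he).1
  · by_cases hd : d = c
    · subst hd
      simpa using hT1
    · simpa only [Function.update_of_ne hd] using hu'.isTab d
  · exact (Function.update_of_ne hd _ _).symm
  · by_cases hd : d = c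
    · subst hd
      simp only [Function.update_self]
      exact h2 _ hT.card
    · simp only [Function.update_of_ne hd]
      rw [← a4 d hd]
      exact hc d

/-! ### Transposing a whole history. -/

/-- The states `s` and `s'` at the cut `t` are reached by parallel sequences of steps, all of whose
tableaux have conjugate shapes. -/
def Conjugate : ℕ → CutState n m → CutState n m → Prop
  | 0, s, s' => Good 0 s ∧ Good 0 s' ∧ ∀ d, Conj (s.tab d) (s'.tab d)
  | t + 1, s, s' => (Good (t + 1) s ∧ Good (t + 1) s' ∧ ∀ d, Conj (s.tab d) (s'.tab d)) ∧
      ∃ u u' c, Conjugate t u u' ∧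
        ((Open t c u s ∧ Open t c u' s') ∨ (Close t c u s ∧ Close t c u' s'))

namespace Conjugate

variable {t : ℕ} {s s' s'' : CutState n m}

theorem good (h : Conjugate t s s') :
    Good t s ∧ Good t s' ∧ ∀ d, Conj (s.tab d) (s'.tab d) := by
  cases t with
  | zero => exact h
  | succ t => exact h.1

theorem symm (h : Conjugate t s s') : Conjugate t s' s := by
  induction t generalizing s s' with
  | zero => exact ⟨h.2.1, h.1, fun d => (h.2.2 d).symm⟩
  | succ t ih =>
    obtain ⟨⟨h1, h2, h3⟩, u, u', c, hu, hstep⟩ := h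
    exact ⟨⟨h2, h1, fun d => (h3 d).symm⟩, u', u, c, ih hu, hstep.imp And.symm And.symm⟩

/-- `s` determines its predecessor, induction the transposed predecessor, and the shapes the step
onwards from it. -/
theorem unique (h : Conjugate t s s') (h' : Conjugate t s s'') : s' = s'' := by
  induction t generalizing s s' s'' with
  | zero =>
    have key : ∀ s : CutState n m, Good 0 s → s = ⟨∅, fun _ _ => ∅⟩ := by
      intro s hs
      refine CutState.ext (Set.eq_empty_iff_forall_notMem.2 fun a ha => ?_)
        (funext fun c => funext fun i => Finset.eq_empty_iff_forall_notMem.2 fun v hv => ?_)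
      · exact Nat.not_lt_zero _ (hs.right_lt a ha)
      · exact Nat.not_lt_zero _ (hs.content_lt c v ⟨i, hv⟩)
    rw [key s' h.2.1, key s'' h'.2.1]
  | succ t ih =>
    obtain ⟨⟨h1, h2, h3⟩, u, u', c, hu, hstep⟩ := h
    obtain ⟨⟨k1, k2, k3⟩, v, v', d, hv, kstep⟩ := h'
    have hc : ∀ e i, (s'.tab e i).card = (s''.tab e i).card := fun e i => (h3 e).card_eq (k3 e) i
    rcases hstep with ⟨o, o'⟩ | ⟨o, o'⟩ <;> rcases kstep with ⟨p, p'⟩ | ⟨p, p'⟩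
    · obtain rfl := o.prev_unique p
      obtain rfl := ih hu hv
      exact o'.next_unique p' h2 k2 hc
    -- Opening makes `t` an entry of `s`, while closing leaves only entries below `t`; so the mixed
    -- cases are void.
    · exact (p.content_lt hv.good.1 c t o.2.1).false.elim
    · exact (o.content_lt hu.good.1 d t p.2.1).false.elim
    · obtain ⟨rfl, rfl⟩ := o.prev_unique p hu.good.1 hv.good.1
      obtain rfl := ih hu hv
      exact o'.next_unique p' hc

end Conjugate

theorem Good.exists_conjugate {t : ℕ} {s : CutState n m} (hs : Good t s) (ht : t ≤ 2 * n) :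
    ∃ s', Conjugate t s s' := by
  induction t generalizing s with
  | zero =>
    refine ⟨s, hs, hs, fun d i j => ?_⟩
    have : ∀ i, s.tab d i = ∅ := fun i => Finset.eq_empty_iff_forall_notMem.2 fun v hv =>
      Nat.not_lt_zero _ (hs.content_lt d v ⟨i, hv⟩)
    simp [this]
  | succ t ih =>
    obtain ⟨u, c, hu, hstep⟩ := hs.exists_prev
    obtain ⟨u', hu'⟩ := ih hu (by omega)
    rcases hstep with h | h
    · obtain ⟨s', h1, h2, h3⟩ := h.exists_conj hu hu'.good.2.1 hs hu'.good.2.2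
      exact ⟨s', ⟨hs, h1, h3⟩, u, u', c, hu', Or.inl ⟨h, h2⟩⟩
    · obtain ⟨s', h1, h2, h3⟩ := h.exists_conj (by omega) hu hu'.good.2.1 hs hu'.good.2.2
      exact ⟨s', ⟨hs, h1, h3⟩, u, u', c, hu', Or.inr ⟨h, h2⟩⟩

end CutState

/-! ### The words of a matching at its cuts. -/

namespace CutState

open Rows

variable {n m : ℕ}

/-- `W` lists the arcs of color `c` in `A` that cross the cut `t`, by decreasing right endpoint. -/
def IsWord (A : Set (ColoredArc n m)) (t : ℕ) (c : Fin m) (W : List (ColoredArc n m)) : Prop :=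
  W.Pairwise (fun a b => b.right < a.right) ∧
    ∀ a, a ∈ W ↔ a ∈ A ∧ a.color = c ∧ (a.left : ℕ) < t ∧ t ≤ a.right

/-- The left endpoints of a list of arcs. -/
def lefts (W : List (ColoredArc n m)) : List ℕ := W.map fun a => (a.left : ℕ)

/-- `s` is the state at the cut `t` of the set of arcs `A`. -/
def IsCut (A : Set (ColoredArc n m)) (t : ℕ) (s : CutState n m) : Prop :=
  s.arcs = {a | a ∈ A ∧ (a.right : ℕ) < t} ∧
    ∀ c, ∃ W, IsWord A t c W ∧ Represents (lefts W) (s.tab c)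

/-- No arc ends at `t`, so the word at `t` is the word at `t + 1` without the entry `t`, if it
occurs there. -/
theorem IsCut.of_open {A : Set (ColoredArc n m)} {t : ℕ} {c : Fin m} {u s : CutState n m}
    (h : IsCut A (t + 1) s) (hs : Good (t + 1) s) (ho : Open t c u s) : IsCut A t u := by
  have hne : ∀ a ∈ A, (a.right : ℕ) ≠ t := by
    intro a ha hat
    have h1 : a ∈ s.arcs := by
      rw [h.1]
      exact ⟨ha, by omega⟩
    exact hs.not_both a h1 t (Or.inr hat) c ho.2.1
  refine ⟨?_, fun d => ?_⟩
  · rw [← ho.1, h.1]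
    ext a
    constructor
    · rintro ⟨h1, h2⟩
      have := hne a h1
      exact ⟨h1, by omega⟩
    · rintro ⟨h1, h2⟩
      exact ⟨h1, by omega⟩
  · obtain ⟨W, ⟨h1, h2⟩, h3⟩ := h.2 d
    refine ⟨W.filter fun a => (a.left : ℕ) < t, ⟨h1.filter _, fun a => ?_⟩, ?_⟩
    · rw [List.mem_filter, h2, decide_eq_true_iff]
      constructor
      · rintro ⟨⟨g1, g2, g3, g4⟩, g5⟩
        exact ⟨g1, g2, g5, by omega⟩
      · rintro ⟨g1, g2, g3, g4⟩
        have := hne a g1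
        exact ⟨⟨g1, g2, by omega, by omega⟩, g3⟩
    · rw [ho.2.2 d]
      have := h3.restrict t
      rwa [lefts, List.filter_map] at this

theorem IsCut.of_close {A : Set (ColoredArc n m)} {t : ℕ} {c : Fin m} {u s : CutState n m}
    (hA : ∀ a ∈ A, ∀ b ∈ A, ∀ v, a.IsEnd v → b.IsEnd v → a = b)
    (h : IsCut A (t + 1) s) (hu : Good t u) (hc : Close t c u s) : IsCut A t u := by
  obtain ⟨a, r, hat, rfl, h1, h2, h3⟩ := hc
  have haA : a ∈ A := by
    have : a ∈ s.arcs := h1 ▸ Set.mem_insert _ _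
    rw [h.1] at this
    exact this.1
  have halr : (a.left : ℕ) < a.right := a.left_lt_right
  have hr : ∀ b ∈ A, (b.right : ℕ) = t → b = a := fun b hb hbt =>
    hA b hb a haA t (Or.inr hbt) (Or.inr hat)
  have hl : ∀ b ∈ A, (b.left : ℕ) ≠ t := fun b hb hbt => by
    have h4 := hA b hb a haA t (Or.inl hbt) (Or.inr hat)
    subst h4
    omega
  refine ⟨?_, fun d => ?_⟩
  · ext b
    constructor
    · intro hb
      have : b ∈ s.arcs := h1 ▸ Set.mem_insert_of_mem _ hb
      rw [h.1] at this
      exact ⟨this.1, hu.right_lt b hb⟩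
    · rintro ⟨hb, hbt⟩
      have h4 : b ∈ s.arcs := by
        rw [h.1]
        exact ⟨hb, by omega⟩
      rw [h1] at h4
      rcases h4 with rfl | h4
      · omega
      · exact h4
  · obtain ⟨W, ⟨w1, w2⟩, w3⟩ := h.2 d
    by_cases hd : d = a.color
    · subst hd
      -- Among the arcs over the cut `t`, `a` has the least right endpoint, so it comes last and its
      -- left endpoint is the one inserted.
      refine ⟨W ++ [a], ⟨?_, fun b => ?_⟩, ?_⟩
      · rw [List.pairwise_append]
        refine ⟨w1, by simp, fun b hb b' hb' => ?_⟩
        rw [List.mem_singleton] at hb'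
        subst hb'
        have := ((w2 b).1 hb).2.2.2
        rw [Fin.lt_def]
        omega
      · rw [List.mem_append, List.mem_singleton, w2]
        constructor
        · rintro (⟨g1, g2, g3, g4⟩ | rfl)
          · have := hl b g1
            exact ⟨g1, g2, by omega, by omega⟩
          · exact ⟨haA, rfl, by omega, hat.ge⟩
        · rintro ⟨g1, g2, g3, g4⟩
          by_cases hb : (b.right : ℕ) = t
          · exact Or.inr (hr b g1 hb)
          · exact Or.inl ⟨g1, g2, by omega, by omega⟩
      · have := w3.insert h3
        rwa [lefts, List.map_append]
    · refine ⟨W, ⟨w1, fun b => ?_⟩, by rwa [h2 d hd]⟩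
      rw [w2]
      constructor
      · rintro ⟨g1, g2, g3, g4⟩
        have := hl b g1
        exact ⟨g1, g2, by omega, by omega⟩
      · rintro ⟨g1, g2, g3, g4⟩
        have : (b.right : ℕ) ≠ t := fun hb => hd (by rw [← g2, hr b g1 hb])
        exact ⟨g1, g2, by omega, by omega⟩

theorem IsWord.sublist {A : Set (ColoredArc n m)} {t : ℕ} {c : Fin m}
    {W l : List (ColoredArc n m)} (h : IsWord A t c W)
    (hl : l.Pairwise fun a b => b.right < a.right)
    (hm : ∀ a ∈ l, a ∈ A ∧ a.color = c ∧ (a.left : ℕ) < t ∧ t ≤ a.right) : l.Sublist W := by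
  have hnd : l.Nodup := hl.imp fun h e => (e ▸ h).false
  have : Std.Antisymm fun a b : ColoredArc n m => b.right < a.right :=
    ⟨fun _ _ h h' => (h.asymm h').elim⟩
  refine List.sublist_of_subperm_of_pairwise (r := fun a b : ColoredArc n m => b.right < a.right)
    (hnd.subperm fun a ha => (h.2 a).2 (hm a ha)) hl h.1

end CutState

/-! ### Transposing matchings and the symmetry. -/

namespace ColoredMatching

open Rows CutState

variable {n m : ℕ}

theorem arcs_disj (M : ColoredMatching n m) :
    ∀ a ∈ M.arcs, ∀ b ∈ M.arcs, ∀ v, a.IsEnd v → b.IsEnd v → a = b := by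
  intro a ha b hb v hav hbv
  have hv : v < 2 * n := by
    rcases hav with h | h
    · exact h ▸ a.left.2
    · exact h ▸ a.right.2
  exact (M.existsUnique_arc ⟨v, hv⟩).unique ⟨ha, hav.imp Fin.ext Fin.ext⟩
    ⟨hb, hbv.imp Fin.ext Fin.ext⟩

/-- The state of a matching at the cut to the right of all vertices. -/
def finalState (M : ColoredMatching n m) : CutState n m := ⟨M.arcs, fun _ _ => ∅⟩

theorem good_finalState (M : ColoredMatching n m) : Good (2 * n) M.finalState := by
  have hc : ∀ v, v ∉ content (fun _ => (∅ : Finset ℕ)) := by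
    rintro v ⟨i, hi⟩
    simp at hi
  refine ⟨fun a _ => a.right.2, fun c v hv => (hc v hv).elim, fun v hv => Or.inl ?_, M.arcs_disj,
    fun _ _ v _ _ => hc v, fun v c d hv => (hc v hv).elim, fun _ => isTab_empty⟩
  obtain ⟨a, ⟨ha, h⟩, -⟩ := M.existsUnique_arc ⟨v, hv⟩
  exact ⟨a, ha, h.imp (congrArg Fin.val) (congrArg Fin.val)⟩

theorem isCut_finalState (M : ColoredMatching n m) : IsCut M.arcs (2 * n) M.finalState := by
  refine ⟨?_, fun c => ⟨[], ⟨List.Pairwise.nil, fun a => ?_⟩, 0, fun _ _ => rfl, WordEquiv.refl _⟩⟩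
  · ext a
    exact ⟨fun h => ⟨h, a.right.2⟩, fun h => h.1⟩
  · have := a.right.2
    constructor
    · intro h
      simp at h
    · rintro ⟨-, -, -, h⟩
      omega

theorem exists_conjugate (M : ColoredMatching n m) :
    ∃ M' : ColoredMatching n m, Conjugate (2 * n) M.finalState M'.finalState := by
  obtain ⟨s', hs'⟩ := M.good_finalState.exists_conjugate le_rfl
  obtain ⟨-, h1, h2⟩ := hs'.good
  -- The transpose of the empty shape is empty, so no arc is left open and `s'` is a matching.
  have hT : ∀ c i, s'.tab c i = ∅ := by
    intro c i
    rw [← Finset.card_eq_zero]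
    by_contra hne
    have := (h2 c).symm i 0
    simp only [finalState, Finset.card_empty] at this
    omega
  have htab : s'.tab = fun _ _ => ∅ := funext fun c => funext fun i => hT c i
  refine ⟨⟨s'.arcs, fun v => ?_⟩, ?_⟩
  · rcases h1.cover v v.2 with ⟨a, ha, hav⟩ | ⟨c, i, hi⟩
    · refine ⟨a, ⟨ha, hav.imp Fin.ext Fin.ext⟩, fun b hb => ?_⟩
      exact h1.arcs_disj b hb.1 a ha v
        (hb.2.imp (congrArg Fin.val) (congrArg Fin.val)) hav
    · simp [hT] at hi
  · convert hs'
    exact CutState.ext rfl htab.symm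

theorem exists_cut_of_conjugate {M M' : ColoredMatching n m}
    (h : Conjugate (2 * n) M.finalState M'.finalState) {t : ℕ} (ht : t ≤ 2 * n) :
    ∃ s s', Conjugate t s s' ∧ IsCut M.arcs t s ∧ IsCut M'.arcs t s' := by
  induction ht using Nat.decreasingInduction with
  | self => exact ⟨_, _, h, M.isCut_finalState, M'.isCut_finalState⟩
  | of_succ t ht ih =>
    obtain ⟨s, s', hc, h1, h2⟩ := ih
    obtain ⟨⟨g1, g2, -⟩, u, u', c, hu, ⟨o, o'⟩ | ⟨o, o'⟩⟩ := hc
    · exact ⟨u, u', hu, h1.of_open g1 o, h2.of_open g2 o'⟩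
    · exact ⟨u, u', hu, h1.of_close M.arcs_disj hu.good.1 o,
        h2.of_close M'.arcs_disj hu.good.2.1 o'⟩

theorem exists_word_chain_iff {M M' : ColoredMatching n m}
    (h : Conjugate (2 * n) M.finalState M'.finalState) {t : ℕ} (ht : t ≤ 2 * n) (c : Fin m) :
    ∃ W W', IsWord M.arcs t c W ∧ IsWord M'.arcs t c W' ∧
      ∀ k, HasChain (· > ·) (lefts W) k ↔ HasChain (· < ·) (lefts W') k := by
  obtain ⟨s, s', hc, h1, h2⟩ := exists_cut_of_conjugate h ht
  obtain ⟨W, w1, w2⟩ := h1.2 c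
  obtain ⟨W', w1', w2'⟩ := h2.2 c
  obtain ⟨g1, g2, g3⟩ := hc.good
  exact ⟨W, W', w1, w1', (g3 c).hasChain (g1.isTab c) (g2.isTab c) w2 w2'⟩

/-- The arcs `a 0, …, a (k - 1)`, ordered by decreasing right endpoint, are a chain at any cut that
separates their left endpoints from their right endpoints. -/
theorem hasChain_of_arcs {M : ColoredMatching n m} {k t : ℕ} {c : Fin m} {r : ℕ → ℕ → Prop}
    (a : Fin k → ColoredArc n m) (ha : ∀ s, a s ∈ M.arcs) (hc : ∀ s, (a s).color = c)
    (hl : ∀ s s', s < s' → r (a s).left (a s').left) (hr : StrictAnti fun s => (a s).right)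
    (ht : ∀ s, ((a s).left : ℕ) < t ∧ t ≤ (a s).right) {W : List (ColoredArc n m)}
    (hW : IsWord M.arcs t c W) : HasChain r (lefts W) k := by
  refine ⟨lefts (List.ofFn a), List.Sublist.map _ (hW.sublist ?_ ?_), ?_, by simp [lefts]⟩
  · rw [List.pairwise_ofFn]
    exact fun i j hij => hr hij
  · intro b hb
    obtain ⟨s, rfl⟩ := (List.mem_ofFn' _ _).1 hb
    exact ⟨ha s, hc s, ht s⟩
  · rw [lefts, List.pairwise_map, List.pairwise_ofFn]
    exact fun i j hij => hl i j hij

theorem exists_arcs_of_hasChain {M : ColoredMatching n m} {k t : ℕ} {c : Fin m}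
    {r : ℕ → ℕ → Prop} {W : List (ColoredArc n m)} (hW : IsWord M.arcs t c W)
    (h : HasChain r (lefts W) k) :
    ∃ a : Fin k → ColoredArc n m, (∀ s, a s ∈ M.arcs) ∧ (∀ s, (a s).color = c) ∧
      (∀ s s', s < s' → r (a s).left (a s').left) ∧ (StrictAnti fun s => (a s).right) ∧
      ∀ s, ((a s).left : ℕ) < t ∧ t ≤ (a s).right := by
  obtain ⟨l, h1, h2, rfl⟩ := h
  obtain ⟨l, hl, rfl⟩ := List.sublist_map_iff.1 h1
  rw [List.pairwise_map, List.pairwise_iff_get] at h2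
  have h3 := List.pairwise_iff_get.1 (hW.1.sublist hl)
  have hm : ∀ i, l.get i ∈ W := fun i => hl.subset (List.get_mem l i)
  rw [List.length_map]
  refine ⟨l.get, fun s => ((hW.2 _).1 (hm s)).1, fun s => ((hW.2 _).1 (hm s)).2.1,
    fun s s' => h2 s s', fun s s' => h3 s s', fun s => ((hW.2 _).1 (hm s)).2.2⟩

theorem HasCrossing.hasNesting {M M' : ColoredMatching n m}
    (h : Conjugate (2 * n) M.finalState M'.finalState) {k : ℕ} (hk : M.HasCrossing k) :
    M'.HasNesting k := by
  rcases k with _ | k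
  · exact ⟨Fin.elim0, fun s => s.elim0, fun s => s.elim0, fun s => s.elim0, fun s => s.elim0,
      fun s => s.elim0⟩
  · obtain ⟨a, a1, a2, a3, a4, a5⟩ := hk
    -- The least right endpoint of the crossing gives a cut below all its arcs. Words run by
    -- decreasing right endpoint, so the arcs are taken in reverse and their left endpoints
    -- decrease.
    obtain ⟨W, W', w1, w2, w3⟩ := exists_word_chain_iff h (t := (a 0).right)
      (a 0).right.2.le (a 0).color
    have hch := hasChain_of_arcs (r := (· > ·)) (fun s => a (Fin.rev s)) (fun s => a1 _)
      (fun s => a2 _ _) (fun s s' hs => a3 (Fin.rev_lt_rev.2 hs))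
      (fun s s' hs => a5 (Fin.rev_lt_rev.2 hs))
      (fun s => ⟨a4 _ _, a5.monotone (Fin.zero_le _)⟩) w1
    obtain ⟨b, b1, b2, b3, b4, b5⟩ := exists_arcs_of_hasChain w2 ((w3 _).1 hch)
    exact ⟨b, b1, fun s s' => (b2 s).trans (b2 s').symm, fun s s' hs => b3 s s' hs,
      fun s s' => Fin.lt_def.2 ((b5 s).1.trans_le (b5 s').2), b4⟩

theorem HasNesting.hasCrossing {M M' : ColoredMatching n m}
    (h : Conjugate (2 * n) M.finalState M'.finalState) {k : ℕ} (hk : M'.HasNesting k) :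
    M.HasCrossing k := by
  rcases k with _ | k
  · exact ⟨Fin.elim0, fun s => s.elim0, fun s => s.elim0, fun s => s.elim0, fun s => s.elim0,
      fun s => s.elim0⟩
  · obtain ⟨a, a1, a2, a3, a4, a5⟩ := hk
    -- In a nesting the innermost arc is the last one, and it has the least right endpoint.
    obtain ⟨W, W', w1, w2, w3⟩ := exists_word_chain_iff h (t := (a (Fin.last k)).right)
      (a (Fin.last k)).right.2.le (a 0).color
    have hch := hasChain_of_arcs (r := (· < ·)) a a1 (fun s => a2 _ _) (fun s s' hs => a3 hs)
      a5 (fun s => ⟨a4 _ _, a5.antitone (Fin.le_last _)⟩) w2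
    obtain ⟨b, b1, b2, b3, b4, b5⟩ := exists_arcs_of_hasChain w1 ((w3 _).2 hch)
    exact ⟨fun s => b (Fin.rev s), fun s => b1 _, fun s s' => (b2 _).trans (b2 _).symm,
      fun s s' hs => b3 _ _ (Fin.rev_lt_rev.2 hs),
      fun s s' => Fin.lt_def.2 ((b5 _).1.trans_le (b5 _).2),
      fun s s' hs => b4 (Fin.rev_lt_rev.2 hs)⟩

theorem crossingNumber_eq_nestingNumber {M M' : ColoredMatching n m}
    (h : Conjugate (2 * n) M.finalState M'.finalState) : M.crossingNumber = M'.nestingNumber := by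
  unfold crossingNumber nestingNumber
  congr 1
  ext k
  exact ⟨fun hk => hk.hasNesting h, fun hk => hk.hasCrossing h⟩

/-- Transposition is injective because the transposed matching determines the original, by
`Conjugate.symm` and `Conjugate.unique`. -/
theorem card_crossing_nesting_le (n m i j : ℕ) :
    Nat.card {M : ColoredMatching n m // M.crossingNumber = i ∧ M.nestingNumber = j} ≤
      Nat.card {M : ColoredMatching n m // M.crossingNumber = j ∧ M.nestingNumber = i} := by
  choose φ hφ using exists_conjugate (n := n) (m := m)
  refine Nat.card_le_card_of_injective (fun M => ⟨φ M.1,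
    (crossingNumber_eq_nestingNumber (hφ M.1).symm).trans M.2.2,
    (crossingNumber_eq_nestingNumber (hφ M.1)).symm.trans M.2.1⟩) fun M M₂ heq => ?_
  have h1 : φ M.1 = φ M₂.1 := congrArg Subtype.val heq
  have h2 := (hφ M.1).symm
  rw [h1] at h2
  exact Subtype.ext (ColoredMatching.ext
    (congrArg CutState.arcs (h2.unique (hφ M₂.1).symm)))

end ColoredMatching

theorem corollary3p2 (n m i j : ℕ) :
    Nat.card {M : ColoredMatching n m // M.crossingNumber = i ∧ M.nestingNumber = j} =
      Nat.card {M : ColoredMatching n m // M.crossingNumber = j ∧ M.nestingNumber = i} :=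
  (ColoredMatching.card_crossing_nesting_le n m i j).antisymm
    (ColoredMatching.card_crossing_nesting_le n m j i)
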